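/- **Setting.** Let $(E,\le)$ be a finite partially ordered index set, let $\mathcal U_S$ ($S\in E$) be finite alphabets, and let $U_E=(U_S:S\in E)$ have an arbitrary joint pmf $p$ on $\prod_{S\in E}\mathcal U_S$. For $A\subseteq E$ write $U_A=(U_S:S\in A)$; entropies are in bits. For $S\in E$ let $\uparrow\! S=\{R\in E:R\ge S\}$; an up-set is a set $G\subseteq E$ with $\uparrow\! S\subseteq G$ for all $S\in G$. For every up-set $G$ put $$\gamma(G)=\sum_{S\in G}H\big(U_S\mid U_{\uparrow S\setminus\{S\}}\big)-H(U_G).$$ **Codebook.** Let $r_S\ge 0$ ($S\in E$) be rates and $r(G)=\sum_{S\in G}r_S$. For each $S$ let $m_S$ range over $\{1,\dots,\lfloor 2^{nr_S}\rfloor\}$. Recursively, from the maximal elements of $E$ downwards, generate for every $S\in E$ and every tuple $m_{\uparrow S}=(m_R:R\ge S)$ a codeword $$u_S^n(m_{\uparrow S})\sim\prod_{t=1}^n p\big(u_{S,t}\mid u_{R,t}(m_{\uparrow R}):R\in\uparrow\! S\setminus\{S\}\big),$$ conditionally independently over $S$-codewords given the codewords with indices $R>S$. Here $p(u_S\mid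 u_{\uparrow S\setminus\{S\}})$ is any fixed version of the conditional pmf (arbitrary where the conditioning event has probability zero). A message tuple $m=(m_S:S\in E)$ selects the codeword tuple $(u_S^n(m_{\uparrow S}):S\in E)$, with empirical joint pmf $\pi_m(a)=\frac1n\,\big|\{t: u_{S,t}(m_{\uparrow S})=a_S\ \forall S\in E\}\big|$. The tuple is called $\epsilon$-typical if $|\pi_m(a)-p(a)|\le\epsilon$ for all $a$, and robustly $\epsilon$-typical if $|\pi_m(a)-p(a)|\le\epsilon\,p(a)$ for all $a$. **Claim.** 1. $\gamma$ defines a contra-polymatroid over the lattice of up-sets: $\gamma(\emptyset)=0$; $\gamma(F\cap G)+\gamma(F\cup G)\ge\gamma(F)+\gamma(G)$ for all up-sets $F,G$; and $\gamma(F)\le\gamma(G)$ for all up-sets $F\subseteq G$. 2. If $r(G)\ge\gamma(G)$ for every up-set $G\subseteq E$, then for every $\epsilon>0$ the probability that the selected codeword tuple is $\epsilon$-typical for some message tuple $m$ tends to one as $n\to\infty$. 3. If, in addition, $r(G)>\gamma(G)$ for every up-set $G$ with $\gamma(G)>0$, then for every $\epsilon>0$ the probability that the selected codeword tuple is robustly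 $\epsilon$-typical for some $m$ also tends to one as $n\to\infty$. -/

import Mathlib

open Filter Topology
open scoped ENNReal

set_option linter.unusedSectionVars false

namespace RecursiveCovering

variable {ι : Type*} [Fintype ι] {𝒰 : ι → Type*} [∀ S, Fintype (𝒰 S)]

/-! ### Entropies of a joint pmf -/

/-- `P(U_R = u_R for all R ∈ A)`: the marginal pmf of `U_A`, evaluated at the coordinates of `u`
in `A`. -/
noncomputable def marginal (p : PMF (∀ S, 𝒰 S)) (A : Set ι) (u : ∀ S, 𝒰 S) : ℝ :=
  (p.toOuterMeasure {v | ∀ R ∈ A, v R = u R}).toReal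

open Classical in
/-- The entropy `H(U_A) = E[- log₂ p(U_A)]`, in bits. -/
noncomputable def entropy (p : PMF (∀ S, 𝒰 S)) (A : Set ι) : ℝ :=
  -∑ u, (p u).toReal * Real.logb 2 (marginal p A u)

open Classical in
/-- The conditional entropy `H(U_A | U_B) = E[- log₂ p(U_A | U_B)]`, in bits. -/
noncomputable def condEntropy (p : PMF (∀ S, 𝒰 S)) (A B : Set ι) : ℝ :=
  -∑ u, (p u).toReal * Real.logb 2 (marginal p (A ∪ B) u / marginal p B u)

/-- `γ(G) = ∑_{S ∈ G} H(U_S | U_{↑S \ S}) - H(U_G)`. -/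
noncomputable def gam [PartialOrder ι] (p : PMF (∀ S, 𝒰 S)) (G : Finset ι) : ℝ :=
  ∑ S ∈ G, condEntropy p {S} (Set.Ici S \ {S}) - entropy p (G : Set ι)

/-- A set function defines a contra-polymatroid over the lattice of up-sets if it is normalized,
supermodular and non-decreasing on up-sets. -/
structure IsContraPolymatroid [PartialOrder ι] [DecidableEq ι] (f : Finset ι → ℝ) : Prop where
  normalized : f ∅ = 0
  supermodular : ∀ F G : Finset ι, IsUpperSet (F : Set ι) → IsUpperSet (G : Set ι) →
    f F + f G ≤ f (F ∩ G) + f (F ∪ G)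
  monotone : ∀ F G : Finset ι, IsUpperSet (F : Set ι) → IsUpperSet (G : Set ι) →
    F ⊆ G → f F ≤ f G

/-! ### Typical tuples of sequences -/

open Classical in
/-- The empirical joint pmf of a tuple of length-`n` sequences: the fraction of the times `t`
with `(x_S(t))_S = a`. -/
noncomputable def empirical {n : ℕ} (x : ∀ S, Fin n → 𝒰 S) (a : ∀ S, 𝒰 S) : ℝ :=
  ((Finset.univ.filter fun t : Fin n => ∀ S, x S t = a S).card : ℝ) / n

/-- The empirical joint pmf is within `ε` of `p`, letter by letter. -/
def IsTypical (p : PMF (∀ S, 𝒰 S)) (ε : ℝ) {n : ℕ} (x : ∀ S, Fin n → 𝒰 S) : Prop :=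
  ∀ a, |empirical x a - (p a).toReal| ≤ ε

/-- Robust typicality: the deviation at the letter `a` is at most `ε p(a)`; in particular, letters
of probability zero do not occur. -/
def IsRobustlyTypical (p : PMF (∀ S, 𝒰 S)) (ε : ℝ) {n : ℕ} (x : ∀ S, Fin n → 𝒰 S) : Prop :=
  ∀ a, |empirical x a - (p a).toReal| ≤ ε * (p a).toReal

/-! ### The random codebook -/

/-- `κ S` is a version of the conditional law of `U_S` given `U_R`, `R > S`; it is unconstrained
where the conditioning event has probability zero. -/
def IsCondLaw [PartialOrder ι] (p : PMF (∀ S, 𝒰 S))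
    (κ : ∀ S, (∀ R : Set.Ioi S, 𝒰 R) → PMF (𝒰 S)) : Prop :=
  ∀ S u, marginal p (Set.Ici S) u =
    marginal p (Set.Ioi S) u * (κ S (fun R => u R) (u S)).toReal

/-- Message tuples `m_{↑S} = (m_R : R ≥ S)`, with `m_R` ranging over `M R` values. -/
abbrev UpMessages [PartialOrder ι] (M : ι → ℕ) (S : ι) : Type _ := ∀ R : Set.Ici S, Fin (M R)

/-- The part of `m_{↑S}` that belongs to `↑R`, for `R ≥ S`. -/
def UpMessages.up [PartialOrder ι] {M : ι → ℕ} {S R : ι} (h : S ≤ R) (m : UpMessages M S) :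
    UpMessages M R := fun Q => m ⟨Q, h.trans Q.2⟩

/-- A codebook holds a length-`n` codeword `u_S^n(m_{↑S})` for each `S` and each `m_{↑S}`. -/
abbrev Codebook [PartialOrder ι] (𝒰 : ι → Type*) (M : ι → ℕ) (n : ℕ) : Type _ :=
  ∀ S, UpMessages M S → Fin n → 𝒰 S

open Classical in
/-- The conditional probability of the codewords of index `S`, given those of the indices `R > S`:
the letters `u_{S,t}(m_{↑S})` are independent, with law `κ S` given the letters at time `t` of the
codewords `u_R^n(m_{↑R})`, `R > S`. -/
noncomputable def layerWeight [PartialOrder ι] (κ : ∀ S, (∀ R : Set.Ioi S, 𝒰 R) → PMF (𝒰 S))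
    (M : ι → ℕ) (n : ℕ) (S : ι) (c : Codebook 𝒰 M n) : ℝ≥0∞ :=
  ∏ m : UpMessages M S, ∏ t : Fin n,
    κ S (fun R => c R (m.up (le_of_lt R.2)) t) (c S m t)

open Classical in
theorem sum_layerWeight_update [PartialOrder ι]
    (κ : ∀ S, (∀ R : Set.Ioi S, 𝒰 R) → PMF (𝒰 S)) (M : ι → ℕ) (n : ℕ) (S : ι)
    (c : Codebook 𝒰 M n) :
    ∑ x : UpMessages M S → Fin n → 𝒰 S, layerWeight κ M n S (Function.update c S x) = 1 := by
  have h : ∀ x : UpMessages M S → Fin n → 𝒰 S,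
      layerWeight κ M n S (Function.update c S x) =
        ∏ m : UpMessages M S, ∏ t : Fin n,
          κ S (fun R => c R (m.up (le_of_lt R.2)) t) (x m t) := by
    intro x
    unfold layerWeight
    refine Finset.prod_congr rfl fun m _ => Finset.prod_congr rfl fun t _ => ?_
    rw [Function.update_self]
    congr 2
    funext R
    rw [Function.update_of_ne (ne_of_gt R.2)]
  simp_rw [h]
  rw [← Fintype.prod_sum (f := fun (m : UpMessages M S) (y : Fin n → 𝒰 S) => ∏ t : Fin n,
    κ S (fun R => c R (m.up (le_of_lt R.2)) t) (y t))]
  refine Finset.prod_eq_one fun m _ => ?_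
  rw [← Fintype.prod_sum (f := fun (t : Fin n) (y : 𝒰 S) =>
    κ S (fun R => c R (m.up (le_of_lt R.2)) t) y)]
  refine Finset.prod_eq_one fun t _ => ?_
  rw [← tsum_fintype (L := .unconditional _)]
  exact PMF.tsum_coe _

/-- The layer of `S` only involves the codewords of the indices `R ≥ S`. -/
theorem layerWeight_congr [PartialOrder ι]
    (κ : ∀ S, (∀ R : Set.Ioi S, 𝒰 R) → PMF (𝒰 S)) (M : ι → ℕ) (n : ℕ) (S : ι)
    (c d : Codebook 𝒰 M n) (h : ∀ R, S ≤ R → c R = d R) :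
    layerWeight κ M n S c = layerWeight κ M n S d := by
  unfold layerWeight
  refine Finset.prod_congr rfl fun m _ => Finset.prod_congr rfl fun t _ => ?_
  rw [h S le_rfl]
  congr 2
  funext R
  rw [h R (le_of_lt R.2)]

open Classical in
/-- Summing out the layers of a down-set `L`, with the other codewords fixed, gives `1`. -/
theorem sum_prod_layerWeight [PartialOrder ι]
    (κ : ∀ S, (∀ R : Set.Ioi S, 𝒰 R) → PMF (𝒰 S)) (M : ι → ℕ) (n : ℕ) (k : ℕ) :
    ∀ (L : Finset ι), L.card = k → IsLowerSet (L : Set ι) → ∀ c : Codebook 𝒰 M n,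
      ∑ d : Codebook 𝒰 M n with (∀ R, R ∉ L → d R = c R),
        ∏ S ∈ L, layerWeight κ M n S d = 1 := by
  induction k with
  | zero =>
    intro L hL _ c
    rw [Finset.card_eq_zero] at hL
    subst hL
    have : (Finset.univ.filter fun d : Codebook 𝒰 M n => ∀ R, R ∉ (∅ : Finset ι) → d R = c R)
        = {c} := by
      ext d
      simp [funext_iff]
    rw [this]
    simp
  | succ k ih =>
    intro L hL hlow c
    obtain ⟨a, haL, hmax⟩ := L.exists_maximal (Finset.card_pos.1 (by omega))
    have hgt : ∀ R, a < R → R ∉ L := fun R hR hRL => absurd (hmax hRL hR.le) (not_le_of_gt hR)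
    have hlow' : IsLowerSet ((L.erase a : Finset ι) : Set ι) := by
      intro x y hyx hx
      simp only [Finset.coe_erase, Set.mem_sdiff, Finset.mem_coe, Set.mem_singleton_iff] at hx ⊢
      refine ⟨hlow hyx hx.1, ?_⟩
      rintro rfl
      exact hgt x (lt_of_le_of_ne hyx (Ne.symm hx.2)) hx.1
    have hcard : (L.erase a).card = k := by rw [Finset.card_erase_of_mem haL]; omega
    rw [← Finset.sum_fiberwise (s := Finset.univ.filter fun d : Codebook 𝒰 M n =>
      ∀ R, R ∉ L → d R = c R) (g := fun d => d a)]
    rw [← sum_layerWeight_update κ M n a c]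
    refine Finset.sum_congr rfl fun x _ => ?_
    have hset : (Finset.univ.filter fun d : Codebook 𝒰 M n => ∀ R, R ∉ L → d R = c R).filter
        (fun d => d a = x) =
        Finset.univ.filter fun d : Codebook 𝒰 M n =>
          ∀ R, R ∉ L.erase a → d R = Function.update c a x R := by
      ext d
      simp only [Finset.mem_filter, Finset.mem_univ, true_and, Finset.mem_erase, not_and]
      constructor
      · rintro ⟨h1, h2⟩ R hR
        by_cases hRa : R = a
        · subst hRa
          rw [Function.update_self, h2]
        · rw [Function.update_of_ne hRa]
          exact h1 R (hR hRa)
      · intro h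
        refine ⟨fun R hR => ?_, ?_⟩
        · have hRa : R ≠ a := fun e => hR (e ▸ haL)
          rw [h R (fun _ => hR), Function.update_of_ne hRa]
        · rw [h a (fun e => absurd rfl e), Function.update_self]
    rw [hset]
    have hterm : ∀ d ∈ Finset.univ.filter (fun d : Codebook 𝒰 M n =>
        ∀ R, R ∉ L.erase a → d R = Function.update c a x R),
        ∏ S ∈ L, layerWeight κ M n S d =
          layerWeight κ M n a (Function.update c a x) *
            ∏ S ∈ L.erase a, layerWeight κ M n S d := by
      intro d hd
      rw [Finset.mem_filter] at hd
      rw [← Finset.mul_prod_erase L _ haL]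
      congr 1
      refine layerWeight_congr κ M n a d _ fun R hR => hd.2 R ?_
      rcases eq_or_lt_of_le hR with rfl | hlt
      · simp
      · exact fun hmem => hgt R hlt (Finset.mem_of_mem_erase hmem)
    rw [Finset.sum_congr rfl hterm, ← Finset.mul_sum,
      ih (L.erase a) hcard hlow' (Function.update c a x), mul_one]

open Classical in
theorem sum_codebookWeight [PartialOrder ι]
    (κ : ∀ S, (∀ R : Set.Ioi S, 𝒰 R) → PMF (𝒰 S)) (M : ι → ℕ) (n : ℕ) :
    ∑ c : Codebook 𝒰 M n, ∏ S, layerWeight κ M n S c = 1 := by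
  classical
  have hne : Nonempty (Codebook 𝒰 M n) := by
    have key : ∀ S, (∀ R, S < R → Nonempty (𝒰 R)) → Nonempty (𝒰 S) := by
      intro S h
      have h' : ∀ R : Set.Ioi S, Nonempty (𝒰 R) := fun R => h R R.2
      obtain ⟨x, _⟩ := (κ S fun R => (h' R).some).support_nonempty
      exact ⟨x⟩
    have hall : ∀ S, Nonempty (𝒰 S) := by
      intro S
      induction S using (wellFounded_gt (α := ι)).induction with
      | _ S ih => exact key S ih
    exact ⟨fun S _ _ => (hall S).some⟩
  have h := sum_prod_layerWeight κ M n _ Finset.univ rfl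
    (by rw [Finset.coe_univ]; exact isLowerSet_univ) hne.some
  simpa using h

open Classical in
/-- The law of the recursively generated codebook, with `M S` messages of index `S` and
blocklength `n`. -/
noncomputable def codebookLaw [PartialOrder ι]
    (κ : ∀ S, (∀ R : Set.Ioi S, 𝒰 R) → PMF (𝒰 S)) (M : ι → ℕ) (n : ℕ) :
    PMF (Codebook 𝒰 M n) :=
  PMF.ofFintype (fun c => ∏ S, layerWeight κ M n S c) (sum_codebookWeight κ M n)

/-- The tuple of codewords that the message tuple `m` selects from the codebook. -/
def codewords [PartialOrder ι] {M : ι → ℕ} {n : ℕ} (c : Codebook 𝒰 M n) (m : ∀ S, Fin (M S)) :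
    ∀ S, Fin n → 𝒰 S := fun S => c S fun R => m R

/-- The number `⌊2^{n r}⌋` of messages of rate `r` at blocklength `n`. -/
noncomputable def numMessages (r : ℝ) (n : ℕ) : ℕ := ⌊(2 : ℝ) ^ ((n : ℝ) * r)⌋₊

end RecursiveCovering

/-!
Write `q(u) = ∏_S κ(u_S | u_R : R > S)` for the law of one letter of a selected codeword tuple.
For an up-set `G` the marginal `q_G` is the product over `S ∈ G` (`margin_refWeight`), so that
`γ(G)` is the relative entropy `D(p_G ‖ q_G)` (`relEntropy_eq_gam`). That `γ` is a contra-polymatroid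
is the submodularity of entropy (`entropy_submodular`).

For the covering claims, let `T` be the robustly typical set, and count the message tuples `m` with
`u(m) ∈ T`, each weighted by the density `p^n / q^n` at `u(m)`. The mean of this count, divided by
the number of message tuples, is `p^n(T) → 1`. Two message tuples that select the same codewords
exactly for `S` in the up-set `A` have codeword tuples that share these codewords and are
conditionally independent given them (`sum_bookWeight_pair`), so they contribute at most
`E_p[1_T p_A^n / q_A^n]` to the second moment. If `γ(A) = 0`, then `p_A = q_A` on the support of `p`
and this is at most one; otherwise it is at most `2 ^ (n (γ(A) + O(ε)))` by typicality, while the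
proportion of such pairs is at most `∏_{S ∈ A} 1 / M_S ≈ 2 ^ (-n r(A))`. Hence the second moment of
the normalized count has limit superior at most one, its variance vanishes, and the count is positive
with probability tending to one (`sum_no_hit_le`, `tendsto_no_hit`). Since pairs with `γ(A) = 0` need
no decay, message sets of rate zero need no separate treatment.

This works for any target law `p ≪ q` with `D(p_G ‖ q_G) < r(G)` wherever the left side is positive.
Robust typicality is the case where the target is the given law. For typicality with non-strict
rate inequalities, the target is `(1 - δ) p + δ q`: it is close to `p`, and by convexity
(`relEntropy_mix_le`) its relative entropies are at most `(1 - δ) γ(G)`.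
-/

namespace RecursiveCovering

/-! ### Marginals of real weights -/

section Margin

variable {I : Type*} [Fintype I] {V : I → Type*} [∀ i, Fintype (V i)]

open Classical in
/-- The marginal on the coordinates in `A` of a real-valued weight `w` on a finite product,
evaluated at the coordinates of `u` in `A`. -/
noncomputable def margin (w : (∀ i, V i) → ℝ) (A : Set I) (u : ∀ i, V i) : ℝ :=
  ∑ v, if ∀ i ∈ A, v i = u i then w v else 0

theorem margin_congr (w : (∀ i, V i) → ℝ) {A : Set I} {u v : ∀ i, V i}
    (h : ∀ i ∈ A, u i = v i) : margin w A u = margin w A v := by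
  classical
  unfold margin
  refine Finset.sum_congr rfl fun x _ => ?_
  have : (∀ i ∈ A, x i = u i) ↔ ∀ i ∈ A, x i = v i :=
    forall₂_congr fun i hi => by rw [h i hi]
  simp only [this]

theorem margin_nonneg {w : (∀ i, V i) → ℝ} (hw : ∀ u, 0 ≤ w u) (A : Set I) (u : ∀ i, V i) :
    0 ≤ margin w A u := by
  classical
  exact Finset.sum_nonneg fun v _ => by split_ifs <;> simp [hw]

theorem le_margin {w : (∀ i, V i) → ℝ} (hw : ∀ u, 0 ≤ w u) (A : Set I) (u : ∀ i, V i) :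
    w u ≤ margin w A u := by
  classical
  unfold margin
  have := Finset.single_le_sum (f := fun v => if ∀ i ∈ A, v i = u i then w v else 0)
    (fun v _ => by split_ifs <;> simp [hw]) (Finset.mem_univ u)
  simpa using this

theorem margin_pos {w : (∀ i, V i) → ℝ} (hw : ∀ u, 0 ≤ w u) (A : Set I) {u : ∀ i, V i}
    (hu : 0 < w u) : 0 < margin w A u :=
  hu.trans_le (le_margin hw A u)

theorem margin_combo (a b : ℝ) (w w' : (∀ i, V i) → ℝ) (A : Set I) (u : ∀ i, V i) :
    margin (fun v => a * w v + b * w' v) A u = a * margin w A u + b * margin w' A u := by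
  classical
  unfold margin
  rw [Finset.mul_sum, Finset.mul_sum, ← Finset.sum_add_distrib]
  exact Finset.sum_congr rfl fun v _ => by split_ifs <;> simp

open Classical in
theorem margin_empty (w : (∀ i, V i) → ℝ) (u : ∀ i, V i) : margin w ∅ u = ∑ v, w v := by
  simp [margin]

open Classical in
/-- Two weights, one of them replaced by its marginal, can be interchanged under the sum against
a function of the coordinates in `A`. -/
theorem sum_mul_margin_comm (w w' : (∀ i, V i) → ℝ) (A : Set I) (g : (∀ i, V i) → ℝ)
    (hg : ∀ u v, (∀ i ∈ A, u i = v i) → g u = g v) :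
    ∑ u, w u * margin w' A u * g u = ∑ u, w' u * margin w A u * g u := by
  classical
  unfold margin
  simp_rw [Finset.mul_sum, Finset.sum_mul]
  rw [Finset.sum_comm]
  refine Finset.sum_congr rfl fun v _ => Finset.sum_congr rfl fun u _ => ?_
  have : (∀ i ∈ A, v i = u i) ↔ ∀ i ∈ A, u i = v i := forall₂_congr fun _ _ => eq_comm
  by_cases h : ∀ i ∈ A, u i = v i
  · rw [if_pos (this.2 h), if_pos h, hg u v h]
    ring
  · rw [if_neg (fun e => h (this.1 e)), if_neg h]
    ring

open Classical in
/-- Change of measure: if `p ≪ q`, the density of `p_A` with respect to `q_A` turns `q`-averages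
of functions of the coordinates in `A` into `p`-averages. -/
theorem sum_mul_density {p q : (∀ i, V i) → ℝ} (hq : ∀ u, 0 ≤ q u)
    (hpq : ∀ u, q u = 0 → p u = 0) (A : Set I) (g : (∀ i, V i) → ℝ)
    (hg : ∀ u v, (∀ i ∈ A, u i = v i) → g u = g v) :
    ∑ u, q u * (margin p A u / margin q A u * g u) = ∑ u, p u * g u := by
  have h := sum_mul_margin_comm q p A (fun u => g u / margin q A u)
    (fun u v huv => by rw [hg u v huv, margin_congr q huv])
  have e : ∀ u, q u * (margin p A u / margin q A u * g u) =
      q u * margin p A u * (g u / margin q A u) := fun u => by ring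
  simp_rw [e]
  rw [h]
  refine Finset.sum_congr rfl fun u _ => ?_
  by_cases hu : q u = 0
  · simp [hpq u hu]
  · have : margin q A u ≠ 0 := (margin_pos hq A (lt_of_le_of_ne (hq u) (Ne.symm hu))).ne'
    field_simp

open Classical in
/-- The weight `p · q_A / p_A`, which has the conditionals of `p` given the coordinates in `A` and
the marginal of `q` on `A`, has mass at most that of `q`. -/
theorem sum_mul_density_le {p q : (∀ i, V i) → ℝ} (hq : ∀ u, 0 ≤ q u) (A : Set I) :
    ∑ u, p u * (margin q A u / margin p A u) ≤ ∑ u, q u := by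
  have h := sum_mul_margin_comm p q A (fun u => 1 / margin p A u)
    (fun u v huv => by rw [margin_congr p huv])
  have e : ∀ u, p u * (margin q A u / margin p A u) =
      p u * margin q A u * (1 / margin p A u) := fun u => by ring
  simp_rw [e]
  rw [h]
  refine Finset.sum_le_sum fun u _ => ?_
  rw [mul_assoc, mul_one_div]
  exact mul_le_of_le_one_right (hq u) (div_self_le_one _)

open Classical in
/-- Conditionally on the coordinates in `A`, a set on which these are constant has mass at most
one. -/
theorem sum_ite_div_margin_le_one {p : (∀ i, V i) → ℝ} (hp : ∀ u, 0 ≤ p u) (A : Set I)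
    (C : (∀ i, V i) → Prop) (v : ∀ i, V i) (hC : ∀ u, C u → ∀ i ∈ A, u i = v i) :
    ∑ u, (if C u then p u / margin p A u else 0) ≤ 1 := by
  have h : ∀ u, (if C u then p u / margin p A u else 0) ≤
      (if ∀ i ∈ A, u i = v i then p u else 0) / margin p A v := by
    intro u
    by_cases hu : C u
    · rw [if_pos hu, if_pos (hC u hu), margin_congr p (hC u hu)]
    · rw [if_neg hu]
      refine div_nonneg ?_ (margin_nonneg hp _ _)
      split_ifs <;> simp [hp]
  refine (Finset.sum_le_sum fun u _ => h u).trans ?_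
  rw [← Finset.sum_div]
  exact div_self_le_one (margin p A v)

end Margin

/-! ### Gibbs' inequality -/

/-- Gibbs' inequality for a density `g` with `∑ p g ≤ 1`. -/
theorem sum_mul_logb_nonpos {α : Type*} [Fintype α] {p g : α → ℝ} (hp : ∀ u, 0 ≤ p u)
    (hp1 : ∑ u, p u = 1) (hg : ∀ u, 0 < p u → 0 < g u) (h1 : ∑ u, p u * g u ≤ 1) :
    ∑ u, p u * Real.logb 2 (g u) ≤ 0 := by
  have hle : ∀ u, p u * Real.log (g u) ≤ p u * g u - p u := fun u => by
    rcases (hp u).eq_or_lt with h | h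
    · simp [← h]
    · nlinarith [Real.log_le_sub_one_of_pos (hg u h)]
  have : ∑ u, p u * Real.log (g u) ≤ 0 := by
    refine (Finset.sum_le_sum fun u _ => hle u).trans ?_
    rw [Finset.sum_sub_distrib, hp1]
    linarith
  have e : ∑ u, p u * Real.logb 2 (g u) = (∑ u, p u * Real.log (g u)) / Real.log 2 := by
    rw [Finset.sum_div]
    exact Finset.sum_congr rfl fun u _ => by rw [Real.logb, mul_div_assoc]
  rw [e]
  exact div_nonpos_of_nonpos_of_nonneg this (Real.log_nonneg (by norm_num))

/-- The equality case of Gibbs' inequality. -/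
theorem eq_one_of_sum_mul_logb_nonneg {α : Type*} [Fintype α] {p g : α → ℝ} (hp : ∀ u, 0 ≤ p u)
    (hp1 : ∑ u, p u = 1) (hg : ∀ u, 0 < p u → 0 < g u) (h1 : ∑ u, p u * g u ≤ 1)
    (h0 : 0 ≤ ∑ u, p u * Real.logb 2 (g u)) {u : α} (hu : 0 < p u) : g u = 1 := by
  by_contra hne
  have hle : ∀ v, p v * Real.log (g v) ≤ p v * g v - p v := fun v => by
    rcases (hp v).eq_or_lt with h | h
    · simp [← h]
    · nlinarith [Real.log_le_sub_one_of_pos (hg v h)]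
  have hlt : p u * Real.log (g u) < p u * g u - p u := by
    nlinarith [Real.log_lt_sub_one_of_pos (hg u hu) hne]
  have : ∑ u, p u * Real.log (g u) < 0 := by
    refine (Finset.sum_lt_sum (fun v _ => hle v) ⟨u, Finset.mem_univ u, hlt⟩).trans_le ?_
    rw [Finset.sum_sub_distrib, hp1]
    linarith
  have e : ∑ u, p u * Real.logb 2 (g u) = (∑ u, p u * Real.log (g u)) / Real.log 2 := by
    rw [Finset.sum_div]
    exact Finset.sum_congr rfl fun u _ => by rw [Real.logb, mul_div_assoc]
  rw [e] at h0
  exact absurd h0 (not_le.2 (div_neg_of_neg_of_pos this (Real.log_pos (by norm_num))))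

/-! ### Entropy and the contra-polymatroid -/

section Entropy

variable {ι : Type*} [Fintype ι] {𝒰 : ι → Type*} [∀ S, Fintype (𝒰 S)]

theorem marginal_eq_margin (p : PMF (∀ S, 𝒰 S)) (A : Set ι) (u : ∀ S, 𝒰 S) :
    marginal p A u = margin (fun v => (p v).toReal) A u := by
  classical
  unfold marginal margin
  rw [PMF.toOuterMeasure_apply_fintype, ENNReal.toReal_sum]
  · refine Finset.sum_congr rfl fun v _ => ?_
    by_cases h : ∀ R ∈ A, v R = u R
    · rw [if_pos h, Set.indicator_of_mem (by exact h)]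
    · rw [if_neg h, Set.indicator_of_notMem (by exact h)]
      rfl
  · intro v _
    exact ne_top_of_le_ne_top (p.apply_ne_top v) (Set.indicator_le_self _ _ _)

theorem sum_toReal_pmf {α : Type*} [Fintype α] (p : PMF α) : ∑ a, (p a).toReal = 1 := by
  rw [← ENNReal.toReal_sum fun a _ => p.apply_ne_top a, ← tsum_fintype (L := .unconditional _),
    p.tsum_coe, ENNReal.toReal_one]

theorem marginal_pos (p : PMF (∀ S, 𝒰 S)) (A : Set ι) {u : ∀ S, 𝒰 S} (hu : 0 < (p u).toReal) :
    0 < marginal p A u := by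
  rw [marginal_eq_margin]
  exact margin_pos (fun _ => ENNReal.toReal_nonneg) A hu

theorem condEntropy_eq_sub (p : PMF (∀ S, 𝒰 S)) (A B : Set ι) :
    condEntropy p A B = entropy p (A ∪ B) - entropy p B := by
  unfold condEntropy entropy
  rw [neg_sub_neg, ← neg_sub, ← Finset.sum_sub_distrib]
  congr 1
  refine Finset.sum_congr rfl fun u _ => ?_
  rcases (ENNReal.toReal_nonneg (a := p u)).eq_or_lt with h | h
  · simp [← h]
  · rw [Real.logb_div (marginal_pos p _ h).ne' (marginal_pos p _ h).ne']
    ring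

open Classical in
/-- The conditional independence coupling of `U_F` and `U_G` given `U_{F ∩ G}` has mass at
most one. -/
theorem sum_mul_marginals_le_one {p : (∀ S, 𝒰 S) → ℝ} (hp : ∀ u, 0 ≤ p u) (hp1 : ∑ u, p u = 1)
    (F G : Set ι) :
    ∑ u, p u * (margin p F u * margin p G u / (margin p (F ∩ G) u * margin p (F ∪ G) u)) ≤ 1 := by
  classical
  set w : (∀ S, 𝒰 S) → ℝ := fun u => p u * (margin p F u / (margin p (F ∩ G) u * margin p (F ∪ G) u))
    with hw
  have e : ∀ u, p u * (margin p F u * margin p G u / (margin p (F ∩ G) u * margin p (F ∪ G) u)) =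
      w u * margin p G u * 1 := fun u => by simp only [hw]; ring
  simp_rw [e]
  rw [sum_mul_margin_comm w p G (fun _ => 1) (fun _ _ _ => rfl)]
  refine (?_ : _ ≤ ∑ u, p u).trans hp1.le
  refine Finset.sum_le_sum fun v _ => ?_
  rw [mul_one]
  refine mul_le_of_le_one_right (hp v) ?_
  -- the mass of `w` on the tuples that agree with `v` on `G`, times `p_{F ∩ G}(v)`: this factor is
  -- constant on these tuples
  have key : ∑ u, (if ∀ i ∈ G, u i = v i then p u * (margin p F u / margin p (F ∪ G) u) else 0) ≤
      margin p (F ∩ G) v := by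
    have e2 : ∀ u, (if ∀ i ∈ G, u i = v i then p u * (margin p F u / margin p (F ∪ G) u) else 0) =
        ∑ x, (if (∀ i ∈ G, u i = v i) ∧ (∀ i ∈ F, x i = u i) then
          p x * (p u / margin p (F ∪ G) u) else 0) := by
      intro u
      by_cases h : ∀ i ∈ G, u i = v i
      · rw [if_pos h]
        have e5 : p u * (margin p F u / margin p (F ∪ G) u) =
            margin p F u * (p u / margin p (F ∪ G) u) := by ring
        rw [e5, show margin p F u = ∑ x, if ∀ i ∈ F, x i = u i then p x else 0 from rfl,
          Finset.sum_mul]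
        refine Finset.sum_congr rfl fun x _ => ?_
        by_cases hx : ∀ i ∈ F, x i = u i
        · rw [if_pos hx, if_pos ⟨h, hx⟩]
        · rw [if_neg hx, if_neg fun e => hx e.2, zero_mul]
      · simp [h]
    simp_rw [e2]
    rw [Finset.sum_comm]
    rw [show margin p (F ∩ G) v = ∑ x, if ∀ i ∈ F ∩ G, x i = v i then p x else 0 by
      unfold margin
      exact Finset.sum_congr rfl fun _ _ => by congr]
    refine Finset.sum_le_sum fun x _ => ?_
    by_cases hx : ∀ i ∈ F ∩ G, x i = v i
    · rw [if_pos hx]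
      have e3 := sum_ite_div_margin_le_one hp (F ∪ G)
        (fun u => (∀ i ∈ G, u i = v i) ∧ (∀ i ∈ F, x i = u i))
        (fun i => if i ∈ F then x i else v i) (by
          rintro u ⟨h1, h2⟩ i hi
          by_cases hF : i ∈ F
          · simp [hF, h2 i hF]
          · simp [hF, h1 i (hi.resolve_left hF)])
      refine le_of_eq_of_le ?_ (mul_le_of_le_one_right (hp x) e3)
      rw [Finset.mul_sum]
      refine Finset.sum_congr rfl fun u _ => ?_
      by_cases hu : (∀ i ∈ G, u i = v i) ∧ (∀ i ∈ F, x i = u i)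
      · rw [if_pos hu, if_pos hu]
      · rw [if_neg hu, if_neg hu, mul_zero]
    · rw [if_neg hx]
      refine (Finset.sum_eq_zero fun u _ => if_neg ?_).le
      rintro ⟨h1, h2⟩
      exact hx fun i hi => (h2 i hi.1).trans (h1 i hi.2)
  have e4 : margin w G v = (∑ u, (if ∀ i ∈ G, u i = v i then
      p u * (margin p F u / margin p (F ∪ G) u) else 0)) / margin p (F ∩ G) v := by
    rw [margin, Finset.sum_div]
    refine Finset.sum_congr rfl fun u _ => ?_
    by_cases h : ∀ i ∈ G, u i = v i
    · rw [if_pos h, if_pos h, hw, ← margin_congr p (fun i (hi : i ∈ F ∩ G) => h i hi.2)]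
      ring
    · simp [h]
  rw [e4]
  exact div_le_one_of_le₀ key (margin_nonneg hp _ _)

theorem entropy_submodular (p : PMF (∀ S, 𝒰 S)) (F G : Set ι) :
    entropy p (F ∩ G) + entropy p (F ∪ G) ≤ entropy p F + entropy p G := by
  classical
  have hp : ∀ u, 0 ≤ (p u).toReal := fun u => ENNReal.toReal_nonneg
  have h := sum_mul_logb_nonpos hp (sum_toReal_pmf p) (g := fun u => marginal p F u * marginal p G u /
      (marginal p (F ∩ G) u * marginal p (F ∪ G) u)) (fun u hu => by
        have h1 := marginal_pos p F hu
        have h2 := marginal_pos p G hu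
        have h3 := marginal_pos p (F ∩ G) hu
        have h4 := marginal_pos p (F ∪ G) hu
        positivity) (by
        simp_rw [marginal_eq_margin]
        exact sum_mul_marginals_le_one hp (sum_toReal_pmf p) F G)
  have e : ∑ u, (p u).toReal * Real.logb 2 (marginal p F u * marginal p G u /
      (marginal p (F ∩ G) u * marginal p (F ∪ G) u)) =
      entropy p (F ∩ G) + entropy p (F ∪ G) - entropy p F - entropy p G := by
    unfold entropy
    simp only [sub_eq_add_neg, ← Finset.sum_neg_distrib, ← Finset.sum_add_distrib]
    refine Finset.sum_congr rfl fun u _ => ?_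
    rcases (hp u).eq_or_lt with h | h
    · simp [← h]
    · have h1 := (marginal_pos p F h).ne'
      have h2 := (marginal_pos p G h).ne'
      have h3 := (marginal_pos p (F ∩ G) h).ne'
      have h4 := (marginal_pos p (F ∪ G) h).ne'
      rw [Real.logb_div (mul_ne_zero h1 h2) (mul_ne_zero h3 h4), Real.logb_mul h1 h2,
        Real.logb_mul h3 h4]
      ring
  linarith

theorem entropy_empty (p : PMF (∀ S, 𝒰 S)) : entropy p ∅ = 0 := by
  classical
  unfold entropy
  simp_rw [marginal_eq_margin, margin_empty, sum_toReal_pmf]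
  simp

variable [PartialOrder ι]

theorem condEntropy_Ici (p : PMF (∀ S, 𝒰 S)) (S : ι) :
    condEntropy p {S} (Set.Ici S \ {S}) = entropy p (Set.Ici S) - entropy p (Set.Ioi S) := by
  rw [condEntropy_eq_sub, show {S} ∪ Set.Ici S \ {S} = Set.Ici S by simp, Set.Ici_sdiff_left]

/-- Adding an element to an up-set increases `γ`, since `H(U_S | U_F) ≤ H(U_S | U_R : R > S)`: this
is submodularity for `↑S` and `F`, which meet in the elements above `S`. -/
theorem gam_le_gam_insert [DecidableEq ι] (p : PMF (∀ S, 𝒰 S)) (F : Finset ι) (S : ι) (hS : S ∉ F)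
    (h : ∀ R, S < R → R ∈ F) : gam p F ≤ gam p (insert S F) := by
  unfold gam
  rw [Finset.sum_insert hS, condEntropy_Ici]
  have hsub := entropy_submodular p (Set.Ici S) (F : Set ι)
  have h1 : Set.Ici S ∩ (F : Set ι) = Set.Ioi S := by
    ext R
    constructor
    · rintro ⟨h1, h2⟩
      exact lt_of_le_of_ne h1 fun e => hS (by rw [e]; exact h2)
    · exact fun hR => ⟨le_of_lt hR, h R hR⟩
  have h2 : Set.Ici S ∪ (F : Set ι) = ((insert S F : Finset ι) : Set ι) := by
    ext R
    simp only [Set.mem_union, Set.mem_Ici, Finset.coe_insert, Set.mem_insert_iff, Finset.mem_coe]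
    constructor
    · rintro (h1 | h1)
      · rcases h1.eq_or_lt with e | e
        · exact Or.inl e.symm
        · exact Or.inr (h R e)
      · exact Or.inr h1
    · rintro (rfl | h1)
      · exact Or.inl le_rfl
      · exact Or.inr h1
  rw [h1, h2] at hsub
  linarith

/-- Monotonicity of `γ`, by adding the elements of `G \ F` from the top downwards. -/
theorem gam_mono [DecidableEq ι] (p : PMF (∀ S, 𝒰 S)) (k : ℕ) : ∀ F G : Finset ι, (G \ F).card = k →
    IsUpperSet (F : Set ι) → IsUpperSet (G : Set ι) → F ⊆ G → gam p F ≤ gam p G := by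
  induction k with
  | zero =>
    intro F G hk _ _ hFG
    rw [hFG.antisymm (Finset.sdiff_eq_empty_iff_subset.1 (Finset.card_eq_zero.1 hk))]
  | succ k ih =>
    intro F G hk hF hG hFG
    obtain ⟨S, hS, hmax⟩ := (G \ F).exists_maximal (Finset.card_pos.1 (by omega))
    rw [Finset.mem_sdiff] at hS
    have hgt : ∀ R, S < R → R ∈ F := by
      intro R hR
      by_contra hRF
      exact absurd (hmax (Finset.mem_sdiff.2 ⟨hG hR.le hS.1, hRF⟩) hR.le) (not_le_of_gt hR)
    refine (gam_le_gam_insert p F S hS.2 hgt).trans (ih (insert S F) G ?_ ?_ hG ?_)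
    · rw [Finset.sdiff_insert, Finset.card_erase_of_mem (Finset.mem_sdiff.2 hS), hk]
      rfl
    · intro R Q hRQ hR
      simp only [Finset.coe_insert, Set.mem_insert_iff, Finset.mem_coe] at hR ⊢
      rcases hR with rfl | hR
      · rcases hRQ.eq_or_lt with e | e
        · exact Or.inl e.symm
        · exact Or.inr (hgt Q e)
      · exact Or.inr (hF hRQ hR)
    · exact Finset.insert_subset hS.1 hFG

theorem isContraPolymatroid_gam [DecidableEq ι] (p : PMF (∀ S, 𝒰 S)) :
    IsContraPolymatroid (gam p) where
  normalized := by simp [gam, entropy_empty]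
  supermodular F G _ _ := by
    unfold gam
    have h := entropy_submodular p (F : Set ι) (G : Set ι)
    have h2 := Finset.sum_union_inter (s₁ := F) (s₂ := G)
      (f := fun S => condEntropy p {S} (Set.Ici S \ {S}))
    rw [Finset.coe_inter, Finset.coe_union]
    linarith
  monotone F G hF hG hFG := gam_mono p _ F G rfl hF hG hFG

end Entropy

/-! ### Recursively generated families -/

section Network

variable {I : Type*} [Fintype I] {V : I → Type*} [∀ i, Fintype (V i)]
  {ι : Type*} [PartialOrder ι]

open Classical in
/-- In a family in which the coordinate `i` is drawn with conditional probabilities `k i`, given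
the coordinates `j` with `par i j`, the coordinates outside a set that contains its parents can
be summed out. The ranks `h` exclude cycles. -/
theorem sum_prod_kernel_eq_one (par : I → I → Prop) (h : I → ι) (hpar : ∀ i j, par i j → h i < h j)
    (k : I → (∀ j, V j) → ℝ)
    (hk : ∀ i c d, c i = d i → (∀ j, par i j → c j = d j) → k i c = k i d)
    (hsum : ∀ i c, ∑ x, k i (Function.update c i x) = 1) (N : ℕ) :
    ∀ (L : Finset I), L.card = N → (∀ i j, par i j → j ∈ L → i ∈ L) → ∀ c : ∀ i, V i,
      ∑ d with (∀ j, j ∉ L → d j = c j), ∏ i ∈ L, k i d = 1 := by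
  induction N with
  | zero =>
    intro L hL _ c
    rw [Finset.card_eq_zero] at hL
    subst hL
    have : (Finset.univ.filter fun d : ∀ i, V i => ∀ j, j ∉ (∅ : Finset I) → d j = c j)
        = {c} := by
      ext d
      simp [funext_iff]
    rw [this]
    simp
  | succ N ih =>
    intro L hL hlow c
    obtain ⟨a, haL, hmax⟩ := L.exists_maximalFor h (Finset.card_pos.1 (by omega))
    have hgt : ∀ j, par a j → j ∉ L := fun j hj hjL =>
      absurd (hmax hjL (hpar a j hj).le) (not_le_of_gt (hpar a j hj))
    have hcard : (L.erase a).card = N := by rw [Finset.card_erase_of_mem haL]; omega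
    rw [← Finset.sum_fiberwise (s := Finset.univ.filter fun d : ∀ i, V i =>
      ∀ j, j ∉ L → d j = c j) (g := fun d => d a)]
    rw [← hsum a c]
    refine Finset.sum_congr rfl fun x _ => ?_
    have hset : (Finset.univ.filter fun d : ∀ i, V i => ∀ j, j ∉ L → d j = c j).filter
        (fun d => d a = x) =
        Finset.univ.filter fun d : ∀ i, V i =>
          ∀ j, j ∉ L.erase a → d j = Function.update c a x j := by
      ext d
      simp only [Finset.mem_filter, Finset.mem_univ, true_and, Finset.mem_erase, not_and]
      constructor
      · rintro ⟨h1, h2⟩ j hj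
        by_cases hja : j = a
        · subst hja
          rw [Function.update_self, h2]
        · rw [Function.update_of_ne hja]
          exact h1 j (hj hja)
      · intro h
        refine ⟨fun j hj => ?_, ?_⟩
        · have hja : j ≠ a := fun e => hj (e ▸ haL)
          rw [h j (fun _ => hj), Function.update_of_ne hja]
        · rw [h a (fun e => absurd rfl e), Function.update_self]
    rw [hset]
    have hterm : ∀ d ∈ Finset.univ.filter (fun d : ∀ i, V i =>
        ∀ j, j ∉ L.erase a → d j = Function.update c a x j),
        ∏ i ∈ L, k i d = k a (Function.update c a x) * ∏ i ∈ L.erase a, k i d := by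
      intro d hd
      rw [Finset.mem_filter] at hd
      rw [← Finset.mul_prod_erase L _ haL]
      congr 1
      refine hk a d _ (hd.2 a (by simp)) fun j hj => hd.2 j ?_
      exact fun hmem => hgt j hj (Finset.mem_of_mem_erase hmem)
    rw [Finset.sum_congr rfl hterm, ← Finset.mul_sum,
      ih (L.erase a) hcard ?_ (Function.update c a x), mul_one]
    intro i j hij hj
    rw [Finset.mem_erase] at hj ⊢
    refine ⟨?_, hlow i j hij hj.2⟩
    rintro rfl
    exact hgt j hij hj.2

open Classical in
/-- The marginal of a recursively generated family on a set that contains its parents is the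
product of the conditional probabilities over that set. -/
theorem margin_prod_kernel (par : I → I → Prop) (h : I → ι)
    (hpar : ∀ i j, par i j → h i < h j)
    (k : I → (∀ j, V j) → ℝ)
    (hk : ∀ i c d, c i = d i → (∀ j, par i j → c j = d j) → k i c = k i d)
    (hsum : ∀ i c, ∑ x, k i (Function.update c i x) = 1) (J : Finset I)
    (hJ : ∀ i j, par i j → i ∈ J → j ∈ J) (c : ∀ i, V i) :
    margin (fun d => ∏ i, k i d) (J : Set I) c = ∏ i ∈ J, k i c := by
  classical
  have h1 := sum_prod_kernel_eq_one par h hpar k hk hsum _ Jᶜ rfl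
    (fun i j hij hj => by
      rw [Finset.mem_compl] at hj ⊢
      exact fun hi => hj (hJ i j hij hi)) c
  simp only [Finset.mem_compl, not_not] at h1
  have h2 : margin (fun d => ∏ i, k i d) (J : Set I) c =
      ∑ d with (∀ j ∈ J, d j = c j), ∏ i, k i d := by
    rw [Finset.sum_filter, margin]
    exact Finset.sum_congr rfl fun d _ => by congr
  rw [h2, ← mul_one (∏ i ∈ J, k i c), ← h1, Finset.mul_sum]
  refine Finset.sum_congr rfl fun d hd => ?_
  rw [Finset.mem_filter] at hd
  rw [← Finset.prod_mul_prod_compl J]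
  congr 1
  exact Finset.prod_congr rfl fun i hi =>
    hk i d c (hd.2 i hi) fun j hj => hd.2 j (hJ i j hj hi)

end Network

/-! ### Memoryless sequences -/

section Sequences

variable {ι : Type*} [Fintype ι] {𝒰 : ι → Type*} [∀ S, Fintype (𝒰 S)]

/-- The `n`-fold product of a weight on tuples of letters, as a weight on tuples of sequences. -/
noncomputable def iid (w : (∀ S, 𝒰 S) → ℝ) (n : ℕ) (x : ∀ S, Fin n → 𝒰 S) : ℝ :=
  ∏ t, w fun S => x S t

theorem iid_nonneg {w : (∀ S, 𝒰 S) → ℝ} (hw : ∀ u, 0 ≤ w u) (n : ℕ) (x : ∀ S, Fin n → 𝒰 S) :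
    0 ≤ iid w n x :=
  Finset.prod_nonneg fun _ _ => hw _

open Classical in
theorem sum_prod_letters {n : ℕ} (f : Fin n → (∀ S, 𝒰 S) → ℝ) :
    ∑ x : ∀ S, Fin n → 𝒰 S, ∏ t, f t (fun S => x S t) = ∏ t, ∑ u, f t u := by
  rw [Fintype.prod_sum]
  exact Fintype.sum_equiv (Equiv.piComm fun S (_ : Fin n) => 𝒰 S) _ _ fun x => rfl

open Classical in
theorem sum_iid {w : (∀ S, 𝒰 S) → ℝ} (hw : ∑ u, w u = 1) (n : ℕ) : ∑ x, iid w n x = 1 := by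
  unfold iid
  rw [sum_prod_letters fun _ => w]
  simp [hw]

theorem margin_iid (w : (∀ S, 𝒰 S) → ℝ) (n : ℕ) (A : Set ι) (x : ∀ S, Fin n → 𝒰 S) :
    margin (iid w n) A x = iid (margin w A) n x := by
  classical
  unfold iid
  unfold margin
  rw [← sum_prod_letters fun t v => if ∀ i ∈ A, v i = x i t then w v else 0]
  refine Finset.sum_congr rfl fun y _ => ?_
  by_cases h : ∀ i ∈ A, y i = x i
  · rw [if_pos h]
    refine Finset.prod_congr rfl fun t _ => ?_
    rw [if_pos fun i hi => congrFun (h i hi) t]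
  · rw [if_neg h]
    push Not at h
    obtain ⟨i, hi, hne⟩ := h
    obtain ⟨t, ht⟩ := Function.ne_iff.1 hne
    refine (Finset.prod_eq_zero (Finset.mem_univ t) ?_).symm
    exact if_neg fun e => ht (e i hi)

open Classical in
/-- The variance of a sum of i.i.d. centred variables. -/
theorem sum_prod_mul_sq {α : Type*} [Fintype α] {p g : α → ℝ} (hp1 : ∑ a, p a = 1)
    (hg : ∑ a, p a * g a = 0) (n : ℕ) :
    ∑ y : Fin n → α, (∏ t, p (y t)) * (∑ t, g (y t)) ^ 2 = n * ∑ a, p a * g a ^ 2 := by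
  induction n with
  | zero => simp
  | succ n ih =>
    rw [← (Fin.consEquiv fun _ : Fin (n + 1) => α).sum_comp, Fintype.sum_prod_type]
    simp only [Fin.consEquiv_apply, Fin.prod_univ_succ, Fin.sum_univ_succ, Fin.cons_zero,
      Fin.cons_succ]
    have h1 : ∑ y : Fin n → α, ∏ t, p (y t) = 1 := by
      rw [← Fintype.prod_sum (f := fun (_ : Fin n) a => p a)]
      simp [hp1]
    have e : ∀ (a : α) (y : Fin n → α), (p a * ∏ t, p (y t)) * (g a + ∑ t, g (y t)) ^ 2 =
        p a * g a ^ 2 * (∏ t, p (y t)) + p a * g a * (2 * ((∏ t, p (y t)) * ∑ t, g (y t))) +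
          p a * ((∏ t, p (y t)) * (∑ t, g (y t)) ^ 2) := fun a y => by ring
    simp_rw [e, Finset.sum_add_distrib, ← Finset.mul_sum, ih, h1, ← Finset.sum_mul, hg, hp1]
    push_cast
    ring

/-- The tuples of sequences that are robustly typical with respect to a real-valued weight. -/
def robustSet (p : (∀ S, 𝒰 S) → ℝ) (ε : ℝ) (n : ℕ) : Set (∀ S, Fin n → 𝒰 S) :=
  {x | ∀ a, |empirical x a - p a| ≤ ε * p a}

theorem natCast_mul_empirical {n : ℕ} (x : ∀ S, Fin n → 𝒰 S) (a : ∀ S, 𝒰 S) :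
    (n : ℝ) * empirical x a = ∑ t, open Classical in if (∀ S, x S t = a S) then (1 : ℝ) else 0 := by
  classical
  unfold empirical
  rw [Finset.sum_boole]
  rcases n.eq_zero_or_pos with rfl | hn
  · simp
  · have : (n : ℝ) ≠ 0 := by positivity
    rw [mul_div_cancel₀ _ this]

/-- Time averages are averages under the empirical pmf. -/
theorem sum_letters_eq {n : ℕ} (x : ∀ S, Fin n → 𝒰 S) (l : (∀ S, 𝒰 S) → ℝ) :
    ∑ t, l (fun S => x S t) = open Classical in n * ∑ a, empirical x a * l a := by
  classical
  rw [Finset.mul_sum]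
  simp_rw [← mul_assoc, natCast_mul_empirical, Finset.sum_mul]
  rw [Finset.sum_comm]
  refine Finset.sum_congr rfl fun t _ => ?_
  rw [Finset.sum_eq_single (fun S => x S t)]
  · simp
  · intro b _ hb
    rw [if_neg fun h => hb (funext fun S => (h S).symm), zero_mul]
  · simp

open Classical in
theorem sum_letters_le_of_mem_robustSet {p : (∀ S, 𝒰 S) → ℝ} {ε : ℝ} {n : ℕ}
    {x : ∀ S, Fin n → 𝒰 S} (hx : x ∈ robustSet p ε n) (l : (∀ S, 𝒰 S) → ℝ) :
    ∑ t, l (fun S => x S t) ≤ n * (∑ a, p a * l a + ε * ∑ a, p a * |l a|) := by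
  rw [sum_letters_eq]
  refine mul_le_mul_of_nonneg_left ?_ (Nat.cast_nonneg n)
  rw [Finset.mul_sum, ← Finset.sum_add_distrib]
  refine Finset.sum_le_sum fun a _ => ?_
  have h1 : (empirical x a - p a) * l a ≤ |empirical x a - p a| * |l a| := by
    rw [← abs_mul]
    exact le_abs_self _
  have h2 := mul_le_mul_of_nonneg_right (hx a) (abs_nonneg (l a))
  linarith

open Classical in
/-- The weak law of large numbers, for robust typicality. -/
theorem exists_sum_not_robust_le {p : (∀ S, 𝒰 S) → ℝ} (hp : ∀ u, 0 ≤ p u) (hp1 : ∑ u, p u = 1)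
    {ε : ℝ} (hε : 0 < ε) :
    ∃ C : ℝ, ∀ n : ℕ, 0 < n →
      ∑ x, (if x ∈ robustSet p ε n then 0 else iid p n x) ≤ C / n := by
  set g : (∀ S, 𝒰 S) → (∀ S, 𝒰 S) → ℝ := fun a u => (if (∀ S, u S = a S) then 1 else 0) - p a with hg
  refine ⟨∑ a, (∑ u, p u * g a u ^ 2) / (ε * p a) ^ 2, fun n hn => ?_⟩
  have hn' : (0 : ℝ) < n := by exact_mod_cast hn
  have hdev : ∀ (x : ∀ S, Fin n → 𝒰 S) a, ∑ t, g a (fun S => x S t) = n * (empirical x a - p a) := by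
    intro x a
    rw [mul_sub, natCast_mul_empirical]
    simp [hg, Finset.sum_sub_distrib]
  have hpt : ∀ x, (if x ∈ robustSet p ε n then 0 else iid p n x) ≤
      ∑ a, iid p n x * (∑ t, g a (fun S => x S t)) ^ 2 / (n ^ 2 * (ε * p a) ^ 2) := by
    intro x
    have hnn : ∀ a, 0 ≤ iid p n x * (∑ t, g a (fun S => x S t)) ^ 2 / (n ^ 2 * (ε * p a) ^ 2) :=
      fun a => div_nonneg (mul_nonneg (iid_nonneg hp n x) (sq_nonneg _)) (by positivity)
    by_cases hx : x ∈ robustSet p ε n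
    · rw [if_pos hx]
      exact Finset.sum_nonneg fun a _ => hnn a
    · rw [if_neg hx]
      simp only [robustSet, Set.mem_ofPred_eq, not_forall, not_le] at hx
      obtain ⟨a, ha⟩ := hx
      refine le_trans ?_ (Finset.single_le_sum (fun a _ => hnn a) (Finset.mem_univ a))
      rcases (hp a).eq_or_lt with h0 | hpos
      · -- a letter of probability zero occurs, so the sequence has probability zero
        rw [← h0] at ha
        have hne : ∑ t, (if (∀ S, x S t = a S) then (1 : ℝ) else 0) ≠ 0 := by
          rw [← natCast_mul_empirical]
          refine mul_ne_zero hn'.ne' fun e => ?_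
          rw [e] at ha
          simp at ha
        obtain ⟨t, -, ht⟩ := Finset.exists_ne_zero_of_sum_ne_zero hne
        have ht' : ∀ S, x S t = a S := by
          by_contra hcon
          exact ht (if_neg hcon)
        have : iid p n x = 0 := by
          refine Finset.prod_eq_zero (Finset.mem_univ t) ?_
          rw [show (fun S => x S t) = a from funext ht', ← h0]
        simp [this]
      · rw [hdev, mul_div_assoc]
        refine le_mul_of_one_le_right (iid_nonneg hp n x) ?_
        rw [one_le_div (by positivity), mul_pow (n : ℝ), ← sq_abs (empirical x a - p a)]
        have : 0 ≤ ε * p a := by positivity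
        gcongr
  refine (Finset.sum_le_sum fun x _ => hpt x).trans ?_
  rw [Finset.sum_comm, Finset.sum_div]
  refine Finset.sum_le_sum fun a _ => ?_
  rw [← Finset.sum_div]
  have hmean : ∑ u, p u * g a u = 0 := by
    have : ∀ u, p u * g a u = (if u = a then p a else 0) - p u * p a := by
      intro u
      by_cases h : u = a
      · subst h
        simp [hg]
        ring
      · rw [if_neg h]
        have h' : ¬ ∀ S, u S = a S := fun e => h (funext e)
        simp [hg, h']
    simp_rw [this, Finset.sum_sub_distrib, ← Finset.sum_mul, hp1]
    simp
  have hvar : ∑ x : ∀ S, Fin n → 𝒰 S, iid p n x * (∑ t, g a (fun S => x S t)) ^ 2 =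
      n * ∑ u, p u * g a u ^ 2 := by
    rw [← sum_prod_mul_sq hp1 hmean n]
    exact Fintype.sum_equiv (Equiv.piComm fun S (_ : Fin n) => 𝒰 S) _ _ fun x => rfl
  rw [hvar]
  apply le_of_eq
  rw [div_div, mul_comm ((ε * p a) ^ 2), pow_two (n : ℝ), mul_assoc, mul_div_mul_left _ _ hn'.ne']

/-! ### Relative entropies of marginals -/

open Classical in
/-- The relative entropy `D(p_A ‖ q_A)` of the marginals on the coordinates in `A`, in bits. -/
noncomputable def relEntropy (p q : (∀ S, 𝒰 S) → ℝ) (A : Set ι) : ℝ :=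
  ∑ u, p u * Real.logb 2 (margin p A u / margin q A u)

theorem margin_pos_of_ac {p q : (∀ S, 𝒰 S) → ℝ} (hq : ∀ u, 0 ≤ q u)
    (hpq : ∀ u, q u = 0 → p u = 0) (A : Set ι) {u : ∀ S, 𝒰 S} (hu : 0 < p u) : 0 < margin q A u :=
  margin_pos hq A (lt_of_le_of_ne (hq u) fun e => hu.ne' (hpq u e.symm))

open Classical in
/-- If `D(p_A ‖ q_A)` vanishes, then `p_A = q_A` on the support of `p`. -/
theorem density_eq_one_of_relEntropy_nonpos {p q : (∀ S, 𝒰 S) → ℝ} (hp : ∀ u, 0 ≤ p u)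
    (hp1 : ∑ u, p u = 1) (hq : ∀ u, 0 ≤ q u) (hq1 : ∑ u, q u = 1)
    (hpq : ∀ u, q u = 0 → p u = 0) {A : Set ι} (h : relEntropy p q A ≤ 0) {u : ∀ S, 𝒰 S}
    (hu : 0 < p u) : margin p A u / margin q A u = 1 := by
  have h1 := eq_one_of_sum_mul_logb_nonneg hp hp1
    (g := fun u => margin q A u / margin p A u)
    (fun v hv => div_pos (margin_pos_of_ac hq hpq A hv) (margin_pos hp A hv))
    ((sum_mul_density_le hq A).trans hq1.le) (by
      have e : ∑ u, p u * Real.logb 2 (margin q A u / margin p A u) = - relEntropy p q A := by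
        unfold relEntropy
        rw [← Finset.sum_neg_distrib]
        refine Finset.sum_congr rfl fun v _ => ?_
        rw [← inv_div, Real.logb_inv]
        ring
      rw [e]
      linarith) hu
  rw [← inv_div, h1, inv_one]

open Classical in
/-- Relative entropy is convex: it decreases at least linearly along the segment from `p` to
`q`. -/
theorem relEntropy_mix_le {p q : (∀ S, 𝒰 S) → ℝ} (hp : ∀ u, 0 ≤ p u) (hq : ∀ u, 0 ≤ q u)
    (hpq : ∀ u, q u = 0 → p u = 0) {δ : ℝ} (h0 : 0 ≤ δ) (h1 : δ ≤ 1) (A : Set ι) :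
    relEntropy (fun u => (1 - δ) * p u + δ * q u) q A ≤ (1 - δ) * relEntropy p q A := by
  have key : ∀ w : (∀ S, 𝒰 S) → ℝ, (∀ u, q u = 0 → w u = 0) → relEntropy w q A =
      ∑ u, q u * (margin w A u / margin q A u * Real.logb 2 (margin w A u / margin q A u)) := by
    intro w hw
    rw [sum_mul_density hq hw A _ fun u v huv => by rw [margin_congr w huv, margin_congr q huv]]
    rfl
  rw [key _ fun u hu => by simp [hu, hpq u hu], key p hpq, Finset.mul_sum]
  refine Finset.sum_le_sum fun u _ => ?_
  rcases (hq u).eq_or_lt with hu | hu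
  · simp [← hu]
  · have hqA := margin_pos hq A hu
    set ρ := margin p A u / margin q A u with hρ
    have hρ0 : 0 ≤ ρ := div_nonneg (margin_nonneg hp A u) hqA.le
    have e : margin (fun u => (1 - δ) * p u + δ * q u) A u / margin q A u =
        (1 - δ) * ρ + δ * 1 := by
      rw [margin_combo, add_div, mul_div_assoc, mul_div_assoc, div_self hqA.ne']
    rw [e]
    have hconv := Real.convexOn_mul_log.2 (Set.mem_Ici.2 hρ0)
      (Set.mem_Ici.2 zero_le_one) (sub_nonneg.2 h1) h0 (by ring)
    simp only [smul_eq_mul, Real.log_one, mul_zero, add_zero] at hconv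
    have h2 : (0 : ℝ) < Real.log 2 := Real.log_pos (by norm_num)
    rw [mul_left_comm (1 - δ) (q u)]
    refine mul_le_mul_of_nonneg_left ?_ hu.le
    unfold Real.logb
    refine le_of_le_of_eq (le_of_eq_of_le ?_ (div_le_div_of_nonneg_right hconv h2.le)) ?_ <;> ring

open Classical in
/-- On the robustly typical set the density of `p_A` with respect to `q_A` is at most
`2 ^ (n (D(p_A ‖ q_A) + O(ε)))`. -/
theorem iid_density_le {p q : (∀ S, 𝒰 S) → ℝ} (hp : ∀ u, 0 ≤ p u) (hq : ∀ u, 0 ≤ q u)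
    (hpq : ∀ u, q u = 0 → p u = 0) (A : Set ι) {ε : ℝ} {n : ℕ} {x : ∀ S, Fin n → 𝒰 S}
    (hx : x ∈ robustSet p ε n) (hx0 : 0 < iid p n x) :
    iid (margin p A) n x / iid (margin q A) n x ≤ 2 ^ (n * (relEntropy p q A +
      ε * ∑ a, p a * |Real.logb 2 (margin p A a / margin q A a)|)) := by
  have hpos : ∀ t, 0 < p fun S => x S t := fun t =>
    lt_of_le_of_ne (hp _) fun e => hx0.ne' (Finset.prod_eq_zero (Finset.mem_univ t) e.symm)
  unfold iid
  rw [← Finset.prod_div_distrib]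
  have e : ∀ t, margin p A (fun S => x S t) / margin q A (fun S => x S t) =
      (2 : ℝ) ^ Real.logb 2 (margin p A (fun S => x S t) / margin q A (fun S => x S t)) := fun t =>
    (Real.rpow_logb (by norm_num) (by norm_num)
      (div_pos (margin_pos hp A (hpos t)) (margin_pos_of_ac hq hpq A (hpos t)))).symm
  rw [Finset.prod_congr rfl fun t _ => e t, ← Real.rpow_sum_of_pos (by norm_num)]
  exact Real.rpow_le_rpow_of_exponent_le (by norm_num)
    (sum_letters_le_of_mem_robustSet hx fun a => Real.logb 2 (margin p A a / margin q A a))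

theorem iid_density_eq_one {p q : (∀ S, 𝒰 S) → ℝ} (hp : ∀ u, 0 ≤ p u) {A : Set ι}
    (h : ∀ u, 0 < p u → margin p A u / margin q A u = 1) {n : ℕ} {x : ∀ S, Fin n → 𝒰 S}
    (hx0 : 0 < iid p n x) : iid (margin p A) n x / iid (margin q A) n x = 1 := by
  have hpos : ∀ t, 0 < p fun S => x S t := fun t =>
    lt_of_le_of_ne (hp _) fun e => hx0.ne' (Finset.prod_eq_zero (Finset.mem_univ t) e.symm)
  unfold iid
  rw [← Finset.prod_div_distrib]
  exact Finset.prod_eq_one fun t _ => h _ (hpos t)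

end Sequences

/-! ### The law of a pair of codeword tuples -/

section Codebook

variable {ι : Type*} [Fintype ι] [PartialOrder ι] {𝒰 : ι → Type*} [∀ S, Fintype (𝒰 S)]

/-- The conditional probability `κ(u_S | u_R : R > S)`, as a real number. -/
noncomputable def condWeight (κ : ∀ S, (∀ R : Set.Ioi S, 𝒰 R) → PMF (𝒰 S)) (S : ι)
    (u : ∀ S, 𝒰 S) : ℝ :=
  (κ S (fun R => u R) (u S)).toReal

/-- The reference law `q(u) = ∏_S κ(u_S | u_R : R > S)`, that of a single letter of a codeword
tuple. -/
noncomputable def refWeight (κ : ∀ S, (∀ R : Set.Ioi S, 𝒰 R) → PMF (𝒰 S)) (u : ∀ S, 𝒰 S) : ℝ :=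
  ∏ S, condWeight κ S u

theorem condWeight_nonneg (κ : ∀ S, (∀ R : Set.Ioi S, 𝒰 R) → PMF (𝒰 S)) (S : ι)
    (u : ∀ S, 𝒰 S) : 0 ≤ condWeight κ S u :=
  ENNReal.toReal_nonneg

theorem refWeight_nonneg (κ : ∀ S, (∀ R : Set.Ioi S, 𝒰 R) → PMF (𝒰 S))
    (u : ∀ S, 𝒰 S) : 0 ≤ refWeight κ u :=
  Finset.prod_nonneg fun _ _ => condWeight_nonneg κ _ u

theorem margin_refWeight (κ : ∀ S, (∀ R : Set.Ioi S, 𝒰 R) → PMF (𝒰 S)) (A : Finset ι)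
    (hA : IsUpperSet (A : Set ι)) (u : ∀ S, 𝒰 S) :
    margin (refWeight κ) (A : Set ι) u = ∏ S ∈ A, condWeight κ S u := by
  classical
  refine margin_prod_kernel (fun S R => S < R) id (fun _ _ h => h) (condWeight κ) ?_ ?_ A
    (fun S R hSR hS => hA hSR.le hS) u
  · intro S c d h1 h2
    unfold condWeight
    rw [h1]
    congr 3
    funext R
    exact h2 R R.2
  · intro S c
    rw [← sum_toReal_pmf (κ S fun R => c R)]
    refine Finset.sum_congr rfl fun x _ => ?_
    unfold condWeight
    rw [Function.update_self]
    congr 3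
    funext R
    rw [Function.update_of_ne (ne_of_gt R.2)]

open Classical in
theorem sum_refWeight (κ : ∀ S, (∀ R : Set.Ioi S, 𝒰 R) → PMF (𝒰 S)) (u : ∀ S, 𝒰 S) :
    ∑ v, refWeight κ v = 1 := by
  have h := margin_refWeight κ ∅ (by simpa using isUpperSet_empty) u
  rwa [Finset.coe_empty, margin_empty, Finset.prod_empty] at h

/-- The codewords of all indices: a node consists of `S` and a message tuple `m_{↑S}`. -/
abbrev Node (M : ι → ℕ) : Type _ := Σ S, UpMessages M S

/-- The node of index `S` that the message tuple `m` selects. -/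
abbrev node {M : ι → ℕ} (m : ∀ S, Fin (M S)) (S : ι) : Node M := ⟨S, fun R => m R⟩

theorem node_injective {M : ι → ℕ} (m : ∀ S, Fin (M S)) : Function.Injective (node m) :=
  fun _ _ h => congrArg Sigma.fst h

/-- The codeword at the node `j` is one of those given which the codeword at `i` is generated. -/
def IsParent {M : ι → ℕ} (i j : Node M) : Prop := ∃ h : i.1 < j.1, i.2.up h.le = j.2

theorem exists_node_of_isParent {M : ι → ℕ} {m : ∀ S, Fin (M S)} {S : ι} {j : Node M}
    (h : IsParent (node m S) j) : ∃ R, S < R ∧ node m R = j := by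
  obtain ⟨R, μ⟩ := j
  obtain ⟨h1, h2⟩ := h
  exact ⟨R, h1, Sigma.ext rfl (heq_of_eq h2)⟩

theorem apply_node_congr {M : ι → ℕ} {n : ℕ} (c : ∀ i : Node M, Fin n → 𝒰 i.1)
    {m m' : ∀ S, Fin (M S)} {S : ι} (h : node m S = node m' S) : c (node m S) = c (node m' S) := by
  have e : (fun R : Set.Ici S => m R) = fun R : Set.Ici S => m' R := eq_of_heq (Sigma.mk.inj h).2
  show c ⟨S, fun R => m R⟩ = c ⟨S, fun R => m' R⟩
  rw [e]

/-- The tuple of codewords that the message tuple `m` selects. -/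
def select {M : ι → ℕ} {n : ℕ} (c : ∀ i : Node M, Fin n → 𝒰 i.1) (m : ∀ S, Fin (M S)) :
    ∀ S, Fin n → 𝒰 S :=
  fun S => c (node m S)

/-- The conditional probability of the codeword at a node, for the codebook `c`. -/
noncomputable def nodeWeight (κ : ∀ S, (∀ R : Set.Ioi S, 𝒰 R) → PMF (𝒰 S)) {M : ι → ℕ} {n : ℕ}
    (i : Node M) (c : ∀ i : Node M, Fin n → 𝒰 i.1) : ℝ :=
  ∏ t, (κ i.1 (fun R => c ⟨R, i.2.up (le_of_lt R.2)⟩ t) (c i t)).toReal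

open Classical in
/-- The probability of the codebook `c`. -/
noncomputable def bookWeight (κ : ∀ S, (∀ R : Set.Ioi S, 𝒰 R) → PMF (𝒰 S)) {M : ι → ℕ} {n : ℕ}
    (c : ∀ i : Node M, Fin n → 𝒰 i.1) : ℝ :=
  ∏ i, nodeWeight κ i c

theorem bookWeight_nonneg (κ : ∀ S, (∀ R : Set.Ioi S, 𝒰 R) → PMF (𝒰 S)) {M : ι → ℕ} {n : ℕ}
    (c : ∀ i : Node M, Fin n → 𝒰 i.1) : 0 ≤ bookWeight κ c :=
  Finset.prod_nonneg fun _ _ => Finset.prod_nonneg fun _ _ => ENNReal.toReal_nonneg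

/-- The conditional probability of the `S`-sequence in a tuple of sequences. -/
noncomputable def seqWeight (κ : ∀ S, (∀ R : Set.Ioi S, 𝒰 R) → PMF (𝒰 S)) {n : ℕ} (S : ι)
    (x : ∀ S, Fin n → 𝒰 S) : ℝ :=
  ∏ t, condWeight κ S fun R => x R t

open Classical in
theorem margin_bookWeight (κ : ∀ S, (∀ R : Set.Ioi S, 𝒰 R) → PMF (𝒰 S)) {M : ι → ℕ} {n : ℕ}
    (J : Finset (Node M)) (hJ : ∀ i j, IsParent i j → i ∈ J → j ∈ J)
    (c : ∀ i : Node M, Fin n → 𝒰 i.1) :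
    margin (bookWeight κ) (J : Set (Node M)) c = ∏ i ∈ J, nodeWeight κ i c := by
  refine margin_prod_kernel IsParent Sigma.fst (fun _ _ h => h.1) (nodeWeight κ) ?_ ?_ J hJ c
  · intro i c d h1 h2
    unfold nodeWeight
    refine Finset.prod_congr rfl fun t _ => ?_
    rw [h1]
    congr 3
    funext R
    rw [h2 ⟨R, i.2.up (le_of_lt R.2)⟩ ⟨R.2, rfl⟩]
  · intro i c
    have h1 : ∑ x : Fin n → 𝒰 i.1,
        ∏ t, (κ i.1 (fun R => c ⟨R, i.2.up (le_of_lt R.2)⟩ t) (x t)).toReal = 1 := by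
      rw [← Fintype.prod_sum (f := fun (t : Fin n) (y : 𝒰 i.1) =>
        (κ i.1 (fun R => c ⟨R, i.2.up (le_of_lt R.2)⟩ t) y).toReal)]
      exact Finset.prod_eq_one fun t _ => sum_toReal_pmf _
    rw [← h1]
    refine Finset.sum_congr rfl fun x _ => ?_
    unfold nodeWeight
    refine Finset.prod_congr rfl fun t _ => ?_
    rw [@Function.update_self _ _ (fun a b => Classical.propDecidable (a = b))]
    congr 3
    funext R
    rw [@Function.update_of_ne _ _ (fun a b => Classical.propDecidable (a = b))]
    exact fun h => (ne_of_gt R.2) (congrArg Sigma.fst h)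

open Classical in
/-- The indices at which two message tuples select the same codeword. -/
noncomputable def agreement {M : ι → ℕ} (m m' : ∀ S, Fin (M S)) : Finset ι :=
  Finset.univ.filter fun S => node m S = node m' S

theorem mem_agreement {M : ι → ℕ} {m m' : ∀ S, Fin (M S)} {S : ι} :
    S ∈ agreement m m' ↔ node m S = node m' S := by
  simp [agreement]

theorem mem_agreement_iff {M : ι → ℕ} {m m' : ∀ S, Fin (M S)} {S : ι} :
    S ∈ agreement m m' ↔ ∀ R, S ≤ R → m R = m' R := by
  rw [mem_agreement]
  constructor
  · intro h R hR
    exact congrFun (eq_of_heq (Sigma.mk.inj h).2) ⟨R, hR⟩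
  · intro h
    refine Sigma.ext rfl (heq_of_eq ?_)
    funext R
    exact h R R.2

theorem isUpperSet_agreement {M : ι → ℕ} (m m' : ∀ S, Fin (M S)) :
    IsUpperSet (agreement m m' : Set ι) := by
  intro S R hSR hS
  rw [Finset.mem_coe, mem_agreement_iff] at hS ⊢
  exact fun Q hQ => hS Q (hSR.trans hQ)

open Classical in
/-- The joint law of the codeword tuples of two messages: they share the codewords in the agreement
set, and are conditionally independent given these. -/
theorem sum_bookWeight_pair (κ : ∀ S, (∀ R : Set.Ioi S, 𝒰 R) → PMF (𝒰 S)) {M : ι → ℕ} {n : ℕ}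
    (m m' : ∀ S, Fin (M S)) (x x' : ∀ S, Fin n → 𝒰 S) :
    ∑ c : ∀ i : Node M, Fin n → 𝒰 i.1, (if select c m = x ∧
        select c m' = x' then bookWeight κ c else 0) =
      if ∀ S ∈ agreement m m', x' S = x S then
        (∏ S, seqWeight κ S x) * ∏ S ∈ (agreement m m')ᶜ, seqWeight κ S x' else 0 := by
  by_cases hx : ∀ S ∈ agreement m m', x' S = x S
  · rw [if_pos hx]
    set d : ∀ i : Node M, Fin n → 𝒰 i.1 := fun i => if i = node m i.1 then x i.1 else x' i.1 with hd
    have hd1 : ∀ S, d (node m S) = x S := fun S => if_pos rfl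
    have hd2 : ∀ S, d (node m' S) = x' S := by
      intro S
      by_cases h : node m' S = node m S
      · rw [apply_node_congr d h, hd1, hx S (mem_agreement.2 h.symm)]
      · exact if_neg h
    set J : Finset (Node M) := Finset.univ.image (node m) ∪ (agreement m m')ᶜ.image (node m') with hJ
    have hmem : ∀ i, i ∈ J ↔ (∃ S, node m S = i) ∨ ∃ S, node m' S = i := by
      intro i
      simp only [hJ, Finset.mem_union, Finset.mem_image, Finset.mem_univ, true_and,
        Finset.mem_compl]
      constructor
      · rintro (h | ⟨S, -, h⟩)
        · exact Or.inl h
        · exact Or.inr ⟨S, h⟩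
      · rintro (h | ⟨S, h⟩)
        · exact Or.inl h
        · by_cases hS : S ∈ agreement m m'
          · exact Or.inl ⟨S, (mem_agreement.1 hS).trans h⟩
          · exact Or.inr ⟨S, hS, h⟩
    have hcl : ∀ i j, IsParent i j → i ∈ J → j ∈ J := by
      intro i j hij hi
      rw [hmem] at hi ⊢
      rcases hi with ⟨S, rfl⟩ | ⟨S, rfl⟩
      · obtain ⟨R, -, hR⟩ := exists_node_of_isParent hij
        exact Or.inl ⟨R, hR⟩
      · obtain ⟨R, -, hR⟩ := exists_node_of_isParent hij
        exact Or.inr ⟨R, hR⟩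
    have hL : ∑ c : ∀ i : Node M, Fin n → 𝒰 i.1, (if select c m = x ∧
        select c m' = x' then bookWeight κ c else 0) =
        margin (bookWeight κ) (J : Set (Node M)) d := by
      unfold margin
      refine Finset.sum_congr (by ext; simp) fun c _ => ?_
      have : (select c m = x ∧ select c m' = x') ↔
          ∀ i ∈ (J : Set (Node M)), c i = d i := by
        simp only [Finset.mem_coe, hmem]
        constructor
        · rintro ⟨h1, h2⟩ i (⟨S, rfl⟩ | ⟨S, rfl⟩)
          · rw [hd1, ← h1]
            rfl
          · rw [hd2, ← h2]
            rfl
        · intro h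
          exact ⟨funext fun S => (h _ (Or.inl ⟨S, rfl⟩)).trans (hd1 S),
            funext fun S => (h _ (Or.inr ⟨S, rfl⟩)).trans (hd2 S)⟩
      by_cases hc : ∀ i ∈ (J : Set (Node M)), c i = d i
      · rw [if_pos (this.2 hc), if_pos hc]
      · rw [if_neg fun h => hc (this.1 h), if_neg hc]
    have hk1 : ∀ S, nodeWeight κ (node m S) d = seqWeight κ S x := by
      intro S
      unfold nodeWeight seqWeight condWeight
      refine Finset.prod_congr rfl fun t _ => ?_
      rw [hd1]
      congr 3
      funext R
      exact congrFun (hd1 R) t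
    have hk2 : ∀ S, nodeWeight κ (node m' S) d = seqWeight κ S x' := by
      intro S
      unfold nodeWeight seqWeight condWeight
      refine Finset.prod_congr rfl fun t _ => ?_
      rw [hd2]
      congr 3
      funext R
      exact congrFun (hd2 R) t
    rw [hL, margin_bookWeight κ J hcl d, Finset.prod_union, Finset.prod_image, Finset.prod_image]
    · simp_rw [hk1, hk2]
    · exact fun _ _ _ _ h => node_injective m' h
    · exact fun _ _ _ _ h => node_injective m h
    · rw [Finset.disjoint_left]
      intro i hi hi'
      obtain ⟨S, -, rfl⟩ := Finset.mem_image.1 hi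
      obtain ⟨R, hR, h⟩ := Finset.mem_image.1 hi'
      have e : R = S := congrArg Sigma.fst h
      subst e
      exact Finset.mem_compl.1 hR (mem_agreement.2 h.symm)
  · rw [if_neg hx]
    refine Finset.sum_eq_zero fun c _ => if_neg ?_
    rintro ⟨h1, h2⟩
    refine hx fun S hS => ?_
    rw [← h1, ← h2]
    exact (apply_node_congr c (mem_agreement.1 hS)).symm

theorem prod_seqWeight (κ : ∀ S, (∀ R : Set.Ioi S, 𝒰 R) → PMF (𝒰 S)) {n : ℕ}
    (x : ∀ S, Fin n → 𝒰 S) : ∏ S, seqWeight κ S x = iid (refWeight κ) n x :=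
  Finset.prod_comm

theorem iid_margin_refWeight (κ : ∀ S, (∀ R : Set.Ioi S, 𝒰 R) → PMF (𝒰 S)) {n : ℕ} (A : Finset ι)
    (hA : IsUpperSet (A : Set ι)) (x : ∀ S, Fin n → 𝒰 S) :
    iid (margin (refWeight κ) (A : Set ι)) n x = ∏ S ∈ A, seqWeight κ S x := by
  unfold iid
  simp_rw [margin_refWeight κ A hA]
  exact Finset.prod_comm

/-! ### The second moment of the weighted number of hits -/

open Classical in
/-- The density of `p^n` with respect to `q^n`, truncated to the set `T`. -/
noncomputable def truncDensity (p q : (∀ S, 𝒰 S) → ℝ) {n : ℕ} (T : Set (∀ S, Fin n → 𝒰 S))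
    (x : ∀ S, Fin n → 𝒰 S) : ℝ :=
  if x ∈ T then iid p n x / iid q n x else 0

theorem truncDensity_mul {p q : (∀ S, 𝒰 S) → ℝ} (hpq : ∀ u, q u = 0 → p u = 0) {n : ℕ}
    (T : Set (∀ S, Fin n → 𝒰 S)) (x : ∀ S, Fin n → 𝒰 S) :
    truncDensity p q T x * iid q n x = open Classical in if x ∈ T then iid p n x else 0 := by
  classical
  unfold truncDensity
  by_cases hx : x ∈ T
  · rw [if_pos hx, if_pos hx]
    by_cases hq : iid q n x = 0
    · obtain ⟨t, ht, h0⟩ := Finset.prod_eq_zero_iff.1 hq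
      have : iid p n x = 0 := Finset.prod_eq_zero ht (hpq _ h0)
      simp [this]
    · rw [div_mul_cancel₀ _ hq]
  · simp [hx]

open Classical in
theorem sum_bookWeight_mul_pair (κ : ∀ S, (∀ R : Set.Ioi S, 𝒰 R) → PMF (𝒰 S)) {M : ι → ℕ} {n : ℕ}
    (m m' : ∀ S, Fin (M S)) (F : (∀ S, Fin n → 𝒰 S) → (∀ S, Fin n → 𝒰 S) → ℝ) :
    ∑ c : ∀ i : Node M, Fin n → 𝒰 i.1,
        bookWeight κ c * F (select c m) (select c m') =
      ∑ x, ∑ x', F x x' * (if ∀ S ∈ agreement m m', x' S = x S then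
        (∏ S, seqWeight κ S x) * ∏ S ∈ (agreement m m')ᶜ, seqWeight κ S x' else 0) := by
  simp_rw [← sum_bookWeight_pair, Finset.mul_sum]
  have e : ∀ c : ∀ i : Node M, Fin n → 𝒰 i.1,
      bookWeight κ c * F (select c m) (select c m') =
      ∑ x, ∑ x', F x x' * (if select c m = x ∧ select c m' = x' then
        bookWeight κ c else 0) := by
    intro c
    rw [Finset.sum_eq_single (select c m), Finset.sum_eq_single (select c m')]
    · rw [if_pos ⟨rfl, rfl⟩, mul_comm]
    · intro y _ hy
      rw [if_neg fun h => hy h.2.symm, mul_zero]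
    · simp
    · intro y _ hy
      exact Finset.sum_eq_zero fun z _ => by rw [if_neg fun h => hy h.1.symm, mul_zero]
    · simp
  simp_rw [e]
  rw [Finset.sum_comm]
  exact Finset.sum_congr rfl fun x _ => Finset.sum_comm

open Classical in
/-- The mean of a weighted hit is `p^n(T)`. -/
theorem sum_bookWeight_mul_truncDensity (κ : ∀ S, (∀ R : Set.Ioi S, 𝒰 R) → PMF (𝒰 S))
    {M : ι → ℕ} {n : ℕ} {p : (∀ S, 𝒰 S) → ℝ} (hpq : ∀ u, refWeight κ u = 0 → p u = 0)
    (T : Set (∀ S, Fin n → 𝒰 S)) (m : ∀ S, Fin (M S)) :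
    ∑ c : ∀ i : Node M, Fin n → 𝒰 i.1,
        bookWeight κ c * truncDensity p (refWeight κ) T (select c m) =
      ∑ x, if x ∈ T then iid p n x else 0 := by
  rw [sum_bookWeight_mul_pair κ m m fun x _ => truncDensity p (refWeight κ) T x]
  refine Finset.sum_congr rfl fun x _ => ?_
  have hagr : agreement m m = Finset.univ := by
    ext S
    simp [mem_agreement]
  rw [Finset.sum_eq_single x]
  · rw [if_pos fun _ _ => rfl, hagr, Finset.compl_univ, Finset.prod_empty, mul_one, prod_seqWeight,
      truncDensity_mul hpq]
  · intro y _ hy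
    rw [if_neg, mul_zero]
    intro h
    exact hy (funext fun S => h S (by rw [hagr]; exact Finset.mem_univ S))
  · simp

open Classical in
/-- The correlation of the weighted hits of two messages: given the shared codewords, the second
weighted hit has conditional mean at most `p_A^n / q_A^n`. -/
theorem sum_bookWeight_mul_truncDensity_pair_le (κ : ∀ S, (∀ R : Set.Ioi S, 𝒰 R) → PMF (𝒰 S))
    {M : ι → ℕ} {n : ℕ} {p : (∀ S, 𝒰 S) → ℝ} (hp : ∀ u, 0 ≤ p u)
    (hpq : ∀ u, refWeight κ u = 0 → p u = 0)
    (T : Set (∀ S, Fin n → 𝒰 S)) (m m' : ∀ S, Fin (M S)) :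
    ∑ c : ∀ i : Node M, Fin n → 𝒰 i.1,
        bookWeight κ c * (truncDensity p (refWeight κ) T (select c m) *
          truncDensity p (refWeight κ) T (select c m')) ≤
      ∑ x, if x ∈ T then iid p n x * (iid (margin p (agreement m m' : Set ι)) n x /
        iid (margin (refWeight κ) (agreement m m' : Set ι)) n x) else 0 := by
  rw [sum_bookWeight_mul_pair κ m m' fun x x' => truncDensity p (refWeight κ) T x *
    truncDensity p (refWeight κ) T x']
  refine Finset.sum_le_sum fun x _ => ?_
  set A := agreement m m'
  have hA : IsUpperSet (A : Set ι) := isUpperSet_agreement m m'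
  set q := refWeight κ
  have hseq : ∀ S (y : ∀ S, Fin n → 𝒰 S), 0 ≤ seqWeight κ S y := fun S y =>
    Finset.prod_nonneg fun _ _ => condWeight_nonneg κ S _
  -- the conditional probability of the second tuple cancels against the density
  have hin : ∀ x', truncDensity p q T x' * ∏ S ∈ Aᶜ, seqWeight κ S x' ≤
      iid p n x' / iid (margin q (A : Set ι)) n x' := by
    intro x'
    have hnn : 0 ≤ iid p n x' / iid (margin q (A : Set ι)) n x' :=
      div_nonneg (iid_nonneg hp n x') (iid_nonneg (margin_nonneg (refWeight_nonneg κ) _) n x')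
    unfold truncDensity
    by_cases hx' : x' ∈ T
    · rw [if_pos hx']
      have hsplit : iid q n x' = iid (margin q (A : Set ι)) n x' * ∏ S ∈ Aᶜ, seqWeight κ S x' := by
        rw [← prod_seqWeight, iid_margin_refWeight κ A hA, Finset.prod_mul_prod_compl]
      rw [hsplit, ← div_div, div_mul_eq_mul_div, mul_div_assoc]
      exact mul_le_of_le_one_right hnn (div_self_le_one _)
    · rw [if_neg hx', zero_mul]
      exact hnn
  have hfac : ∀ x', truncDensity p q T x * truncDensity p q T x' *
      (if ∀ S ∈ A, x' S = x S then (∏ S, seqWeight κ S x) * ∏ S ∈ Aᶜ, seqWeight κ S x' else 0) ≤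
      (if x ∈ T then iid p n x else 0) * ((if ∀ S ∈ (A : Set ι), x' S = x S then iid p n x' else 0) /
        iid (margin q (A : Set ι)) n x) := by
    intro x'
    by_cases h : ∀ S ∈ A, x' S = x S
    · have h' : ∀ S ∈ (A : Set ι), x' S = x S := h
      rw [if_pos h, if_pos h', ← truncDensity_mul hpq, prod_seqWeight]
      have e : iid (margin q (A : Set ι)) n x = iid (margin q (A : Set ι)) n x' := by
        rw [← margin_iid, ← margin_iid, margin_congr _ h']
      rw [e]
      have e2 : truncDensity p q T x * truncDensity p q T x' *
          (iid q n x * ∏ S ∈ Aᶜ, seqWeight κ S x') = truncDensity p q T x * iid q n x *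
            (truncDensity p q T x' * ∏ S ∈ Aᶜ, seqWeight κ S x') := by ring
      rw [e2]
      refine mul_le_mul_of_nonneg_left (hin x') ?_
      rw [truncDensity_mul hpq]
      split_ifs
      · exact iid_nonneg hp n x
      · exact le_rfl
    · have h' : ¬ ∀ S ∈ (A : Set ι), x' S = x S := h
      rw [if_neg h, if_neg h']
      simp
  refine (Finset.sum_le_sum fun x' _ => hfac x').trans ?_
  rw [← Finset.mul_sum, ← Finset.sum_div]
  have hmar : ∑ x', (if ∀ S ∈ (A : Set ι), x' S = x S then iid p n x' else 0) =
      iid (margin p (A : Set ι)) n x := by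
    rw [← margin_iid]
    unfold margin
    exact Finset.sum_congr rfl fun _ _ => by congr
  rw [hmar]
  split_ifs
  · exact le_rfl
  · rw [zero_mul]

open Classical in
/-- The number of message tuples that agree with a given one on `A`. -/
theorem sum_agree_mul_prod {M : ι → ℕ} (m : ∀ S, Fin (M S)) (A : Finset ι) :
    (∑ m' : ∀ S, Fin (M S), if ∀ S ∈ A, m S = m' S then (1 : ℝ) else 0) * ∏ S ∈ A, (M S : ℝ) =
      ∏ S, (M S : ℝ) := by
  have e : ∀ m' : ∀ S, Fin (M S), (if ∀ S ∈ A, m S = m' S then (1 : ℝ) else 0) =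
      ∏ S, (if S ∈ A → m S = m' S then (1 : ℝ) else 0) := by
    intro m'
    rw [Finset.prod_ite_zero]
    simp
  simp_rw [e]
  rw [← Fintype.prod_sum (f := fun S (j : Fin (M S)) => if S ∈ A → m S = j then (1 : ℝ) else 0),
    ← Finset.prod_mul_prod_compl A]
  have h1 : ∏ S ∈ A, ∑ j : Fin (M S), (if S ∈ A → m S = j then (1 : ℝ) else 0) = 1 :=
    Finset.prod_eq_one fun S hS => by simp [hS]
  have h2 : ∏ S ∈ Aᶜ, ∑ j : Fin (M S), (if S ∈ A → m S = j then (1 : ℝ) else 0) =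
      ∏ S ∈ Aᶜ, (M S : ℝ) :=
    Finset.prod_congr rfl fun S hS => by simp [Finset.mem_compl.1 hS]
  rw [h1, h2, one_mul, mul_comm, Finset.prod_mul_prod_compl]

open Classical in
/-- Chebyshev's inequality for the number of messages whose codeword tuple is in `T`, each weighted
by the density of `p^n` with respect to `q^n`: the probability that there is none. -/
theorem sum_no_hit_le (κ : ∀ S, (∀ R : Set.Ioi S, 𝒰 R) → PMF (𝒰 S))
    {M : ι → ℕ} (hM : ∀ S, 0 < M S) {n : ℕ} {p : (∀ S, 𝒰 S) → ℝ} (hp : ∀ u, 0 ≤ p u)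
    (hp1 : ∑ u, p u = 1) (hpq : ∀ u, refWeight κ u = 0 → p u = 0)
    (T : Set (∀ S, Fin n → 𝒰 S)) (η : Finset ι → ℝ) (hη0 : ∀ A, 0 ≤ η A)
    (hη : ∀ A : Finset ι, IsUpperSet (A : Set ι) → ∀ x ∈ T, 0 < iid p n x →
      iid (margin p (A : Set ι)) n x / iid (margin (refWeight κ) (A : Set ι)) n x ≤ 1 + η A) :
    ∑ c : ∀ i : Node M, Fin n → 𝒰 i.1,
        (if ∃ m, select c m ∈ T then 0 else bookWeight κ c) ≤
      2 * ∑ x, (if x ∈ T then 0 else iid p n x) + ∑ A, η A / ∏ S ∈ A, (M S : ℝ) := by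
  set q := refWeight κ
  set K : ℝ := ∏ S, (M S : ℝ) with hK
  have hMr : ∀ S, (0 : ℝ) < M S := fun S => by exact_mod_cast hM S
  have hK0 : 0 < K := Finset.prod_pos fun S _ => hMr S
  have hcard : (∑ _m : ∀ S, Fin (M S), (1 : ℝ)) = K := by
    simp [hK]
  set f : (∀ i : Node M, Fin n → 𝒰 i.1) → (∀ S, Fin (M S)) → ℝ := fun c m =>
    truncDensity p q T (select c m) with hf
  set PT : ℝ := ∑ x, if x ∈ T then iid p n x else 0 with hPT
  have hPT1 : ∑ x, (if x ∈ T then 0 else iid p n x) = 1 - PT := by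
    rw [eq_sub_iff_add_eq, hPT, ← Finset.sum_add_distrib, ← sum_iid hp1 n]
    exact Finset.sum_congr rfl fun x _ => by split_ifs <;> simp
  have hPTle : PT ≤ 1 := by
    rw [← sub_nonneg, ← hPT1]
    exact Finset.sum_nonneg fun x _ => by
      split_ifs
      exacts [le_rfl, iid_nonneg hp n x]
  have hW1 : ∑ c : ∀ i : Node M, Fin n → 𝒰 i.1, bookWeight κ c = 1 := by
    have hne : Nonempty (∀ S, 𝒰 S) := by
      by_contra hcon
      rw [not_nonempty_iff] at hcon
      rw [Finset.univ_eq_empty, Finset.sum_empty] at hp1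
      exact zero_ne_one hp1
    have h := margin_bookWeight κ (∅ : Finset (Node M)) (by simp)
      (fun i (_ : Fin n) => hne.some i.1)
    rw [Finset.coe_empty, margin_empty, Finset.prod_empty] at h
    convert h
  have hfirst : ∑ c, bookWeight κ c * ∑ m, f c m = K * PT := by
    simp_rw [Finset.mul_sum]
    rw [Finset.sum_comm, ← hcard, Finset.sum_mul]
    refine Finset.sum_congr rfl fun m _ => ?_
    rw [one_mul]
    exact sum_bookWeight_mul_truncDensity κ hpq T m
  have hpair : ∀ m m', ∑ c, bookWeight κ c * (f c m * f c m') ≤ 1 + η (agreement m m') := by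
    intro m m'
    refine (sum_bookWeight_mul_truncDensity_pair_le κ hp hpq T m m').trans ?_
    have : ∀ x, (if x ∈ T then iid p n x * (iid (margin p (agreement m m' : Set ι)) n x /
        iid (margin (refWeight κ) (agreement m m' : Set ι)) n x) else 0) ≤
        (if x ∈ T then iid p n x else 0) * (1 + η (agreement m m')) := by
      intro x
      by_cases hx : x ∈ T
      · rw [if_pos hx, if_pos hx]
        rcases (iid_nonneg hp n x).eq_or_lt with h | h
        · simp [← h]
        · exact mul_le_mul_of_nonneg_left (hη _ (isUpperSet_agreement m m') x hx h) h.le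
      · rw [if_neg hx, if_neg hx, zero_mul]
    refine (Finset.sum_le_sum fun x _ => this x).trans ?_
    rw [← Finset.sum_mul]
    exact mul_le_of_le_one_left (by linarith [hη0 (agreement m m')]) hPTle
  have hcount : ∀ A : Finset ι, ∀ m : ∀ S, Fin (M S),
      (∑ m' : ∀ S, Fin (M S), if ∀ S ∈ A, m S = m' S then (1 : ℝ) else 0) =
        K / ∏ S ∈ A, (M S : ℝ) := by
    intro A m
    rw [eq_div_iff (Finset.prod_pos fun S _ => hMr S).ne']
    exact sum_agree_mul_prod m A
  have hsecond : ∑ c, bookWeight κ c * (∑ m, f c m) ^ 2 ≤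
      K ^ 2 * (1 + ∑ A, η A / ∏ S ∈ A, (M S : ℝ)) := by
    have e : ∑ c, bookWeight κ c * (∑ m, f c m) ^ 2 =
        ∑ m, ∑ m', ∑ c, bookWeight κ c * (f c m * f c m') := by
      have e1 : ∀ c, bookWeight κ c * (∑ m, f c m) ^ 2 =
          ∑ m, ∑ m', bookWeight κ c * (f c m * f c m') := by
        intro c
        rw [pow_two, Finset.sum_mul_sum, Finset.mul_sum]
        exact Finset.sum_congr rfl fun m _ => by rw [Finset.mul_sum]
      simp_rw [e1]
      rw [Finset.sum_comm]
      exact Finset.sum_congr rfl fun m _ => Finset.sum_comm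
    rw [e]
    have h1 : ∀ m m' : ∀ S, Fin (M S), 1 + η (agreement m m') ≤
        1 + ∑ A, η A * (if ∀ S ∈ A, m S = m' S then 1 else 0) := by
      intro m m'
      have hnn : ∀ A ∈ Finset.univ, 0 ≤ η A * (if ∀ S ∈ A, m S = m' S then 1 else 0) :=
        fun A _ => mul_nonneg (hη0 A) (by split_ifs <;> simp)
      have := Finset.single_le_sum hnn (Finset.mem_univ (agreement m m'))
      rw [if_pos fun S hS => mem_agreement_iff.1 hS S le_rfl, mul_one] at this
      linarith
    refine (Finset.sum_le_sum fun m _ => Finset.sum_le_sum fun m' _ =>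
      (hpair m m').trans (h1 m m')).trans ?_
    simp_rw [Finset.sum_add_distrib, hcard]
    have e2 : ∀ m : ∀ S, Fin (M S),
        ∑ m' : ∀ S, Fin (M S), ∑ A, η A * (if ∀ S ∈ A, m S = m' S then (1 : ℝ) else 0) =
        ∑ A, η A * (K / ∏ S ∈ A, (M S : ℝ)) := by
      intro m
      rw [Finset.sum_comm]
      exact Finset.sum_congr rfl fun A _ => by rw [← Finset.mul_sum, hcount A m]
    simp_rw [e2]
    have e3 : ∀ y : ℝ, ∑ _m : ∀ S, Fin (M S), y = K * y := by
      intro y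
      rw [← hcard, Finset.sum_mul]
      simp
    rw [e3, e3, mul_add, mul_one, pow_two, Finset.mul_sum, Finset.mul_sum]
    refine le_of_eq ?_
    congr 1
    exact Finset.sum_congr rfl fun A _ => by ring
  have hpt : ∀ c : ∀ i : Node M, Fin n → 𝒰 i.1,
      (if ∃ m, select c m ∈ T then 0 else bookWeight κ c) ≤
      bookWeight κ c * (∑ m, f c m) ^ 2 / K ^ 2 - 2 * (bookWeight κ c * ∑ m, f c m) / K +
        bookWeight κ c := by
    intro c
    have hsq : bookWeight κ c * (∑ m, f c m) ^ 2 / K ^ 2 - 2 * (bookWeight κ c * ∑ m, f c m) / K +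
        bookWeight κ c = bookWeight κ c * ((∑ m, f c m) / K - 1) ^ 2 := by
      field_simp
      ring
    -- without a hit the count is zero, so its normalized deviation from one is exactly one
    by_cases h : ∃ m, select c m ∈ T
    · rw [if_pos h, hsq]
      exact mul_nonneg (bookWeight_nonneg κ c) (sq_nonneg _)
    · rw [if_neg h]
      have : ∑ m, f c m = 0 := Finset.sum_eq_zero fun m _ => if_neg fun hm => h ⟨m, hm⟩
      simp [this]
  refine (Finset.sum_le_sum fun c _ => hpt c).trans ?_
  rw [Finset.sum_add_distrib, Finset.sum_sub_distrib, ← Finset.sum_div, ← Finset.sum_div,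
    ← Finset.mul_sum, hfirst, hW1, hPT1]
  have h2 : (∑ c, bookWeight κ c * (∑ m, f c m) ^ 2) / K ^ 2 ≤
      1 + ∑ A, η A / ∏ S ∈ A, (M S : ℝ) := by
    rw [div_le_iff₀ (by positivity), mul_comm]
    exact hsecond
  have h3 : 2 * (K * PT) / K = 2 * PT := by field_simp
  rw [h3]
  linarith

end Codebook

/-! ### Rates above the relative entropies suffice -/

section Covering

variable {ι : Type*} [Fintype ι] [PartialOrder ι] {𝒰 : ι → Type*} [∀ S, Fintype (𝒰 S)]

theorem one_le_two_rpow {r : ℝ} (hr : 0 ≤ r) (n : ℕ) : (1 : ℝ) ≤ 2 ^ ((n : ℝ) * r) :=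
  Real.one_le_rpow (by norm_num) (mul_nonneg (Nat.cast_nonneg n) hr)

theorem numMessages_pos {r : ℝ} (hr : 0 ≤ r) (n : ℕ) : 0 < numMessages r n :=
  Nat.floor_pos.2 (one_le_two_rpow hr n)

theorem half_rpow_le_numMessages {r : ℝ} (hr : 0 ≤ r) (n : ℕ) :
    (2 : ℝ) ^ ((n : ℝ) * r) / 2 ≤ numMessages r n := by
  have h1 : (2 : ℝ) ^ ((n : ℝ) * r) < numMessages r n + 1 := Nat.lt_floor_add_one _
  have h2 : (1 : ℝ) ≤ numMessages r n := by exact_mod_cast numMessages_pos hr n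
  linarith

theorem rpow_div_le_prod_numMessages {r : ι → ℝ} (hr : ∀ S, 0 ≤ r S) (n : ℕ) (A : Finset ι) :
    (2 : ℝ) ^ ((n : ℝ) * ∑ S ∈ A, r S) / 2 ^ A.card ≤ ∏ S ∈ A, (numMessages (r S) n : ℝ) := by
  rw [Finset.mul_sum, Real.rpow_sum_of_pos (by norm_num), ← Finset.prod_const,
    ← Finset.prod_div_distrib]
  exact Finset.prod_le_prod (fun S _ => by positivity)
    fun S _ => half_rpow_le_numMessages (hr S) n

theorem tendsto_rpow_div_prod_numMessages {r : ι → ℝ} (hr : ∀ S, 0 ≤ r S) (A : Finset ι) {d : ℝ}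
    (hd : d < ∑ S ∈ A, r S) :
    Tendsto (fun n : ℕ => (2 : ℝ) ^ ((n : ℝ) * d) / ∏ S ∈ A, (numMessages (r S) n : ℝ)) atTop
      (𝓝 0) := by
  have hgeo : Tendsto (fun n : ℕ => (2 : ℝ) ^ A.card * ((2 : ℝ) ^ (d - ∑ S ∈ A, r S)) ^ n) atTop
      (𝓝 0) := by
    rw [← mul_zero ((2 : ℝ) ^ A.card)]
    refine (tendsto_pow_atTop_nhds_zero_of_lt_one (by positivity) ?_).const_mul _
    exact Real.rpow_lt_one_of_one_lt_of_neg (by norm_num) (by linarith)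
  refine squeeze_zero (fun n => by positivity) (fun n => ?_) hgeo
  have h1 := rpow_div_le_prod_numMessages hr n A
  have hpos : (0 : ℝ) < 2 ^ ((n : ℝ) * ∑ S ∈ A, r S) / 2 ^ A.card := by positivity
  refine (div_le_div_of_nonneg_left (by positivity) hpos h1).trans (le_of_eq ?_)
  rw [← Real.rpow_natCast ((2 : ℝ) ^ (d - ∑ S ∈ A, r S)) n, ← Real.rpow_mul (by norm_num),
    mul_comm _ (n : ℝ), mul_sub, Real.rpow_sub (by norm_num)]
  field_simp

theorem robustSet_mono {p : (∀ S, 𝒰 S) → ℝ} (hp : ∀ u, 0 ≤ p u) {ε ε' : ℝ} (h : ε ≤ ε') (n : ℕ) :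
    robustSet p ε n ⊆ robustSet p ε' n :=
  fun _ hx a => (hx a).trans (mul_le_mul_of_nonneg_right h (hp a))

open Classical in
/-- If the rates exceed all relative entropies `D(p_G ‖ q_G)` that do not vanish, some codeword
tuple is robustly typical for `p`, with probability tending to one. -/
theorem tendsto_no_hit (κ : ∀ S, (∀ R : Set.Ioi S, 𝒰 R) → PMF (𝒰 S)) {r : ι → ℝ}
    (hr : ∀ S, 0 ≤ r S) {p : (∀ S, 𝒰 S) → ℝ} (hp : ∀ u, 0 ≤ p u) (hp1 : ∑ u, p u = 1)
    (hpq : ∀ u, refWeight κ u = 0 → p u = 0)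
    (hG : ∀ G : Finset ι, IsUpperSet (G : Set ι) → 0 < relEntropy p (refWeight κ) (G : Set ι) →
      relEntropy p (refWeight κ) (G : Set ι) < ∑ S ∈ G, r S) {ε : ℝ} (hε : 0 < ε) :
    Tendsto (fun n : ℕ => ∑ c : ∀ i : Node fun S => numMessages (r S) n, Fin n → 𝒰 i.1,
      (if ∃ m, select c m ∈ robustSet p ε n then 0 else bookWeight κ c)) atTop (𝓝 0) := by
  set q := refWeight κ
  have hne : Nonempty (∀ S, 𝒰 S) := by
    by_contra hcon
    rw [not_nonempty_iff] at hcon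
    rw [Finset.univ_eq_empty, Finset.sum_empty] at hp1
    exact zero_ne_one hp1
  have hq : ∀ u, 0 ≤ q u := refWeight_nonneg κ
  have hq1 : ∑ u, q u = 1 := sum_refWeight κ hne.some
  set l : Finset ι → ℝ := fun A => ∑ a, p a * |Real.logb 2 (margin p (A : Set ι) a /
    margin q (A : Set ι) a)| with hl
  -- a smaller tolerance keeps the exponents below the rates
  obtain ⟨ε', ⟨hε'0, hε'1⟩, hε'⟩ : ∃ ε' ∈ Set.Ioo 0 ε, ∀ A : Finset ι, IsUpperSet (A : Set ι) →
      0 < relEntropy p q (A : Set ι) →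
      relEntropy p q (A : Set ι) + ε' * l A < ∑ S ∈ A, r S := by
    have h1 : ∀ᶠ ε' in 𝓝[>] (0 : ℝ), ∀ A : Finset ι, IsUpperSet (A : Set ι) →
        0 < relEntropy p q (A : Set ι) →
        relEntropy p q (A : Set ι) + ε' * l A < ∑ S ∈ A, r S := by
      rw [eventually_all]
      intro A
      by_cases hA : IsUpperSet (A : Set ι) ∧ 0 < relEntropy p q (A : Set ι)
      · have hc : Continuous fun ε' : ℝ => relEntropy p q (A : Set ι) + ε' * l A := by fun_prop
        have := (hc.tendsto 0).mono_left (nhdsWithin_le_nhds (s := Set.Ioi (0 : ℝ)))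
        have hlt : relEntropy p q (A : Set ι) + 0 * l A < ∑ S ∈ A, r S := by
          simpa using hG A hA.1 hA.2
        filter_upwards [this.eventually (gt_mem_nhds hlt)] with ε' h _ _ using h
      · exact Eventually.of_forall fun _ h1 h2 => absurd ⟨h1, h2⟩ hA
    obtain ⟨ε', h2, h3⟩ := (h1.and (Ioo_mem_nhdsGT hε)).exists
    exact ⟨ε', h3, h2⟩
  set η : ℕ → Finset ι → ℝ := fun n A =>
    if IsUpperSet (A : Set ι) ∧ 0 < relEntropy p q (A : Set ι) then
      (2 : ℝ) ^ ((n : ℝ) * (relEntropy p q (A : Set ι) + ε' * l A)) else 0 with hη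
  obtain ⟨C, hC⟩ := exists_sum_not_robust_le hp hp1 hε'0
  have hbound : ∀ n : ℕ, 0 < n →
      ∑ c : ∀ i : Node fun S => numMessages (r S) n, Fin n → 𝒰 i.1,
        (if ∃ m, select c m ∈ robustSet p ε n then 0 else bookWeight κ c) ≤
      2 * (C / n) + ∑ A, η n A / ∏ S ∈ A, (numMessages (r S) n : ℝ) := by
    intro n hn
    have h1 := sum_no_hit_le κ (fun S => numMessages_pos (hr S) n) hp hp1 hpq
      (robustSet p ε' n) (η n)
      (fun A => by
        simp only [hη]
        split_ifs
        · positivity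
        · exact le_rfl)
      (fun A hA x hx hx0 => by
        simp only [hη]
        by_cases hD : 0 < relEntropy p q (A : Set ι)
        · rw [if_pos ⟨hA, hD⟩]
          have := iid_density_le hp hq hpq (A : Set ι) hx hx0
          linarith
        · rw [if_neg fun h => hD h.2, add_zero]
          exact (iid_density_eq_one hp (fun u hu =>
            density_eq_one_of_relEntropy_nonpos hp hp1 hq hq1 hpq (not_lt.1 hD) hu) hx0).le)
    refine le_trans (Finset.sum_le_sum fun c _ => ?_) (h1.trans ?_)
    · by_cases h : ∃ m, select c m ∈ robustSet p ε' n
      · obtain ⟨m, hm⟩ := h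
        rw [if_pos ⟨m, robustSet_mono hp hε'1.le n hm⟩, if_pos ⟨m, hm⟩]
      · rw [if_neg h]
        split_ifs
        · exact bookWeight_nonneg κ c
        · exact le_rfl
    · have := hC n hn
      linarith
  have hlim : Tendsto (fun n : ℕ => 2 * (C / n) +
      ∑ A, η n A / ∏ S ∈ A, (numMessages (r S) n : ℝ)) atTop (𝓝 0) := by
    have h1 : Tendsto (fun n : ℕ => 2 * (C / (n : ℝ))) atTop (𝓝 (2 * 0)) :=
      (tendsto_const_div_atTop_nhds_zero_nat C).const_mul 2
    have h2 : Tendsto (fun n : ℕ => ∑ A, η n A / ∏ S ∈ A, (numMessages (r S) n : ℝ)) atTop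
        (𝓝 (∑ _A : Finset ι, 0)) := by
      refine tendsto_finsetSum _ fun A _ => ?_
      simp only [hη]
      by_cases hA : IsUpperSet (A : Set ι) ∧ 0 < relEntropy p q (A : Set ι)
      · simp only [if_pos hA]
        exact tendsto_rpow_div_prod_numMessages hr A (hε' A hA.1 hA.2)
      · simp only [if_neg hA, zero_div]
        exact tendsto_const_nhds
    simpa using h1.add h2
  refine tendsto_of_tendsto_of_tendsto_of_le_of_le' tendsto_const_nhds hlim ?_ ?_
  · refine Eventually.of_forall fun n => Finset.sum_nonneg fun c _ => ?_
    split_ifs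
    · exact le_rfl
    · exact bookWeight_nonneg κ c
  · filter_upwards [eventually_gt_atTop 0] with n hn using hbound n hn

/-! ### The law of the codebook -/

theorem toReal_codebookLaw (κ : ∀ S, (∀ R : Set.Ioi S, 𝒰 R) → PMF (𝒰 S)) (M : ι → ℕ) (n : ℕ)
    (c : ∀ i : Node M, Fin n → 𝒰 i.1) :
    (codebookLaw κ M n fun S μ => c ⟨S, μ⟩).toReal = bookWeight κ c := by
  classical
  unfold codebookLaw bookWeight
  rw [PMF.ofFintype_apply, ENNReal.toReal_prod]
  refine Eq.trans (Finset.prod_congr rfl fun S _ => ?_) (Fintype.prod_sigma _).symm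
  unfold layerWeight
  rw [ENNReal.toReal_prod]
  refine Finset.prod_congr (by ext; simp) fun μ _ => ?_
  rw [ENNReal.toReal_prod]
  rfl

/-- The covering theorem in terms of `codebookLaw`. -/
theorem tendsto_codebookLaw (κ : ∀ S, (∀ R : Set.Ioi S, 𝒰 R) → PMF (𝒰 S)) {r : ι → ℝ}
    (hr : ∀ S, 0 ≤ r S) {p : (∀ S, 𝒰 S) → ℝ} (hp : ∀ u, 0 ≤ p u)
    (hp1 : open Classical in ∑ u, p u = 1)
    (hpq : ∀ u, refWeight κ u = 0 → p u = 0)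
    (hG : ∀ G : Finset ι, IsUpperSet (G : Set ι) → 0 < relEntropy p (refWeight κ) (G : Set ι) →
      relEntropy p (refWeight κ) (G : Set ι) < ∑ S ∈ G, r S) {ε : ℝ} (hε : 0 < ε)
    (good : ∀ n : ℕ, (∀ S, Fin n → 𝒰 S) → Prop)
    (hgood : ∀ n, ∀ x ∈ robustSet p ε n, good n x) :
    Tendsto (fun n : ℕ => (codebookLaw κ (fun S => numMessages (r S) n) n).toOuterMeasure
      {c | ∃ m, good n (codewords c m)}) atTop (𝓝 1) := by
  classical
  have hle : ∀ n : ℕ, (codebookLaw κ (fun S => numMessages (r S) n) n).toOuterMeasure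
      {c | ∃ m, good n (codewords c m)} ≤ 1 := fun n => by
    rw [PMF.toOuterMeasure_apply_fintype, ← (codebookLaw κ _ n).tsum_coe,
      tsum_fintype (L := .unconditional _)]
    exact Finset.sum_le_sum fun c _ => Set.indicator_le_self _ _ _
  rw [← ENNReal.tendsto_toReal_iff (fun n => ne_top_of_le_ne_top ENNReal.one_ne_top (hle n))
    ENNReal.one_ne_top, ENNReal.toReal_one]
  have hlim := (tendsto_no_hit κ hr hp hp1 hpq hG hε).const_sub 1
  rw [sub_zero] at hlim
  refine tendsto_of_tendsto_of_tendsto_of_le_of_le hlim tendsto_const_nhds (fun n => ?_)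
    fun n => ENNReal.toReal_mono ENNReal.one_ne_top (hle n)
  dsimp only
  set M : ι → ℕ := fun S => numMessages (r S) n
  rw [sub_le_iff_le_add, PMF.toOuterMeasure_apply_fintype, ENNReal.toReal_sum,
    ← sum_toReal_pmf (codebookLaw κ M n)]
  swap
  · exact fun c _ => ne_top_of_le_ne_top (PMF.apply_ne_top _ c) (Set.indicator_le_self _ _ _)
  have hsum : ∑ c : ∀ i : Node M, Fin n → 𝒰 i.1,
      (if ∃ m, select c m ∈ robustSet p ε n then 0 else bookWeight κ c) =
      ∑ c : Codebook 𝒰 M n, (if ∃ m, codewords c m ∈ robustSet p ε n then 0 else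
        (codebookLaw κ M n c).toReal) := by
    refine Fintype.sum_equiv (Equiv.piCurry fun S (_ : UpMessages M S) => Fin n → 𝒰 S) _ _
      fun c => ?_
    rw [← toReal_codebookLaw]
    rfl
  rw [hsum, ← Finset.sum_add_distrib]
  refine Finset.sum_le_sum fun c _ => ?_
  by_cases h : ∃ m, good n (codewords c m)
  · rw [Set.indicator_of_mem (by exact h)]
    refine le_add_of_nonneg_right ?_
    split_ifs <;> simp
  · rw [Set.indicator_of_notMem (by exact h), if_neg]
    · simp
    · rintro ⟨m, hm⟩
      exact h ⟨m, hgood n _ hm⟩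

/-! ### Versions of the conditional laws -/

theorem condWeight_eq_div {p : PMF (∀ S, 𝒰 S)} {κ : ∀ S, (∀ R : Set.Ioi S, 𝒰 R) → PMF (𝒰 S)}
    (hκ : IsCondLaw p κ) (S : ι) {u : ∀ S, 𝒰 S} (hu : 0 < (p u).toReal) :
    condWeight κ S u = marginal p (Set.Ici S) u / marginal p (Set.Ioi S) u := by
  rw [hκ S u, mul_div_cancel_left₀ _ (marginal_pos p _ hu).ne']
  rfl

theorem toReal_eq_zero_of_refWeight_eq_zero {p : PMF (∀ S, 𝒰 S)}
    {κ : ∀ S, (∀ R : Set.Ioi S, 𝒰 R) → PMF (𝒰 S)} (hκ : IsCondLaw p κ) {u : ∀ S, 𝒰 S}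
    (h : refWeight κ u = 0) : (p u).toReal = 0 := by
  by_contra hne
  have hu : 0 < (p u).toReal := lt_of_le_of_ne ENNReal.toReal_nonneg (Ne.symm hne)
  obtain ⟨S, -, hS⟩ := Finset.prod_eq_zero_iff.1 h
  rw [condWeight_eq_div hκ S hu] at hS
  exact (div_pos (marginal_pos p _ hu) (marginal_pos p _ hu)).ne' hS

/-- `γ(G) = D(p_G ‖ q_G)`. -/
theorem relEntropy_eq_gam {p : PMF (∀ S, 𝒰 S)} {κ : ∀ S, (∀ R : Set.Ioi S, 𝒰 R) → PMF (𝒰 S)}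
    (hκ : IsCondLaw p κ) (G : Finset ι) (hG : IsUpperSet (G : Set ι)) :
    relEntropy (fun u => (p u).toReal) (refWeight κ) (G : Set ι) = gam p G := by
  classical
  have h1 : ∀ S, condEntropy p {S} (Set.Ici S \ {S}) =
      -∑ u, (p u).toReal * Real.logb 2 (condWeight κ S u) := by
    intro S
    rw [condEntropy_Ici]
    unfold entropy
    rw [neg_sub_neg, ← neg_sub, ← Finset.sum_sub_distrib]
    congr 1
    refine Finset.sum_congr rfl fun u _ => ?_
    rcases (ENNReal.toReal_nonneg (a := p u)).eq_or_lt with h | h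
    · simp [← h]
    · rw [condWeight_eq_div hκ S h,
        Real.logb_div (marginal_pos p _ h).ne' (marginal_pos p _ h).ne']
      ring
  unfold gam
  simp_rw [h1]
  unfold entropy
  rw [sub_neg_eq_add, Finset.sum_neg_distrib, Finset.sum_comm, neg_add_eq_sub,
    ← Finset.sum_sub_distrib]
  unfold relEntropy
  refine Finset.sum_congr rfl fun u _ => ?_
  rcases (ENNReal.toReal_nonneg (a := p u)).eq_or_lt with h | h
  · simp [← h]
  · have hne : ∀ S ∈ G, condWeight κ S u ≠ 0 := fun S _ => by
      rw [condWeight_eq_div hκ S h]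
      exact (div_pos (marginal_pos p _ h) (marginal_pos p _ h)).ne'
    rw [← marginal_eq_margin, margin_refWeight κ G hG,
      Real.logb_div (marginal_pos p _ h).ne' (Finset.prod_ne_zero_iff.2 hne),
      Real.logb_prod G _ hne, mul_sub, Finset.mul_sum]

end Covering

end RecursiveCovering

theorem lemma1 {ι : Type*} [Fintype ι] [DecidableEq ι] [PartialOrder ι]
    {𝒰 : ι → Type*} [∀ S, Fintype (𝒰 S)] (p : PMF (∀ S, 𝒰 S)) :
    -- the bound defines a contra-polymatroid over the lattice of up-sets
    RecursiveCovering.IsContraPolymatroid (RecursiveCovering.gam p) ∧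
    -- covering, for every version of the conditional laws and all rates in the polyhedron
    ∀ κ : ∀ S, (∀ R : Set.Ioi S, 𝒰 R) → PMF (𝒰 S), RecursiveCovering.IsCondLaw p κ →
    ∀ r : ι → ℝ, (∀ S, 0 ≤ r S) →
    (∀ G : Finset ι, IsUpperSet (G : Set ι) → RecursiveCovering.gam p G ≤ ∑ S ∈ G, r S) →
    ∀ ε : ℝ, 0 < ε →
      Tendsto (fun n : ℕ =>
        (RecursiveCovering.codebookLaw κ
          (fun S => RecursiveCovering.numMessages (r S) n) n).toOuterMeasure
            {c | ∃ m, RecursiveCovering.IsTypical p ε (RecursiveCovering.codewords c m)})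
        atTop (𝓝 1) ∧
      -- robust typicality, if the binding inequalities are strict
      ((∀ G : Finset ι, IsUpperSet (G : Set ι) → 0 < RecursiveCovering.gam p G →
          RecursiveCovering.gam p G < ∑ S ∈ G, r S) →
        Tendsto (fun n : ℕ =>
          (RecursiveCovering.codebookLaw κ
            (fun S => RecursiveCovering.numMessages (r S) n) n).toOuterMeasure
              {c | ∃ m, RecursiveCovering.IsRobustlyTypical p ε
                (RecursiveCovering.codewords c m)})
          atTop (𝓝 1)) := by
  classical
  refine ⟨RecursiveCovering.isContraPolymatroid_gam p, fun κ hκ r hr hle ε hε => ⟨?_, ?_⟩⟩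
  · have hp : ∀ u, 0 ≤ (p u).toReal := fun u => ENNReal.toReal_nonneg
    have hp1 : ∑ u, (p u).toReal = 1 := by
      convert RecursiveCovering.sum_toReal_pmf p
    have hpq : ∀ u, RecursiveCovering.refWeight κ u = 0 → (p u).toReal = 0 := fun u hu =>
      RecursiveCovering.toReal_eq_zero_of_refWeight_eq_zero hκ hu
    set q := RecursiveCovering.refWeight κ
    have hq : ∀ u, 0 ≤ q u := RecursiveCovering.refWeight_nonneg κ
    obtain ⟨u₀, -⟩ := p.support_nonempty
    have hq1 : ∑ u, q u = 1 := by
      convert RecursiveCovering.sum_refWeight κ u₀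
    have hpa : ∀ u, (p u).toReal ≤ 1 := fun u => ENNReal.toReal_le_of_le_ofReal zero_le_one
      (by simpa using p.coe_le_one u)
    have hqa : ∀ u, q u ≤ 1 := fun u =>
      hq1.le.trans' (Finset.single_le_sum (fun v _ => hq v) (Finset.mem_univ u))
    -- the target is moved slightly from `p` towards `q`, which makes the rate bounds strict
    set δ : ℝ := min (ε / 2) (1 / 2) with hδ
    have hδ0 : 0 < δ := lt_min (by linarith) (by norm_num)
    have hδ1 : δ ≤ 1 / 2 := min_le_right _ _
    have hδε : δ ≤ ε / 2 := min_le_left _ _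
    set p' : (∀ S, 𝒰 S) → ℝ := fun u => (1 - δ) * (p u).toReal + δ * q u with hp'
    have hp'0 : ∀ u, 0 ≤ p' u := fun u =>
      add_nonneg (mul_nonneg (by linarith) (hp u)) (mul_nonneg hδ0.le (hq u))
    have hp'a : ∀ u, p' u ≤ 1 := fun u => by
      have h1 := mul_le_mul_of_nonneg_left (hpa u) (show 0 ≤ 1 - δ by linarith)
      have h2 := mul_le_mul_of_nonneg_left (hqa u) hδ0.le
      simp only [hp']
      linarith
    have hp'1 : ∑ u, p' u = 1 := by
      simp only [hp']
      rw [Finset.sum_add_distrib, ← Finset.mul_sum, ← Finset.mul_sum, hq1]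
      rw [hp1]
      ring
    refine RecursiveCovering.tendsto_codebookLaw κ hr hp'0 (by convert hp'1)
      (fun u hu => by simp [hp', hpq u hu, show q u = 0 from hu]) ?_ (ε := ε / 2) (by linarith)
      (fun n x => RecursiveCovering.IsTypical p ε x) ?_
    · intro G hG h0
      have h1 := RecursiveCovering.relEntropy_mix_le hp hq hpq hδ0.le (by linarith) (G : Set ι)
      rw [RecursiveCovering.relEntropy_eq_gam hκ G hG] at h1
      have h2 : 0 < RecursiveCovering.gam p G := by
        by_contra hcon
        have := mul_nonpos_of_nonneg_of_nonpos (show 0 ≤ 1 - δ by linarith) (not_lt.1 hcon)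
        linarith
      have h3 := hle G hG
      nlinarith
    · intro n x hx a
      have h1 := hx a
      have h2 : |p' a - (p a).toReal| ≤ δ := by
        have e : p' a - (p a).toReal = δ * (q a - (p a).toReal) := by
          simp only [hp']
          ring
        rw [e, abs_mul, abs_of_pos hδ0]
        refine mul_le_of_le_one_right hδ0.le (abs_le.2 ⟨?_, ?_⟩)
        · linarith [hq a, hpa a]
        · linarith [hp a, hqa a]
      have h3 := abs_sub_le (RecursiveCovering.empirical x a) (p' a) (p a).toReal
      have h4 : ε / 2 * p' a ≤ ε / 2 :=
        mul_le_of_le_one_right (by linarith) (hp'a a)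
      linarith
  · intro hlt
    refine RecursiveCovering.tendsto_codebookLaw κ hr (p := fun u => (p u).toReal)
      (fun u => ENNReal.toReal_nonneg) (by convert RecursiveCovering.sum_toReal_pmf p)
      (fun u hu => RecursiveCovering.toReal_eq_zero_of_refWeight_eq_zero hκ hu) ?_ hε
      (fun n x => RecursiveCovering.IsRobustlyTypical p ε x) fun n x hx => hx
    intro G hG
    rw [RecursiveCovering.relEntropy_eq_gam hκ G hG]
    exact hlt G hG
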